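/- Let $\mathscr A$ be a unital $C^*$-algebra and $n\ge 0$. Let $L(\mathscr A^{\otimes n},\mathscr A)$ be the Banach space of bounded operators for the projective tensor norm, i.e. of bounded $n$-linear maps $\mathscr A^n\to\mathscr A$. Let $h=h^*\in\mathscr A$ and let $(\alpha_t)_{t\in\mathbb R}$ be a one-parameter group of $*$-automorphisms of $\mathscr A$ such that $t\mapsto\alpha_t(h)$ is norm differentiable at $0$. Put $\nabla a=\frac{d}{dt}\big|_{t=0}\alpha_t(a)$ wherever the derivative exists; in particular $\nabla h$ is defined. *Spectral functions.* Let $\mathcal C_{\mathrm{Spec}}(n,h)$ be the set of functions $f=f(x_0,\dots,x_n)$, complex valued, that are $C^\infty$ on $U^{n+1}$ for some open $U\subset\mathbb R$ containing $\mathrm{Spec}(h)$ (in particular it contains $C_c^\infty(U^{n+1})$). *Rearrangement operators.* For $g\in C_c^\infty(\mathbb R^{n+1})$ let $\widehat g(\xi)=(2\pi)^{-(n+1)}\int g(x)e^{-ix\cdot\xi}\,dx$ and let $\mathscr S_h(g)\in L(\mathscr A^{\otimes n},\mathscr A)$ be $$\mathscr S_h(g)(\rho_1\otimes\cdots\otimes\rho_n)=\int_{\mathbb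 R^{n+1}}\widehat g(\xi)\,e^{i\xi_0h}\rho_1e^{i\xi_1h}\cdots\rho_ne^{i\xi_nh}\,d\xi .$$ For $f\in\mathcal C_{\mathrm{Spec}}(n,h)$ put $\mathscr S_h(f)=\mathscr S_h(g)$, where $g\in C_c^\infty(\mathbb R^{n+1})$ is any function equal to $f$ on a neighbourhood of $\mathrm{Spec}(h)^{n+1}$. Put $\nabla(\mathscr S_h(f))=\frac{d}{dt}\big|_{t=0}\mathscr S_{\alpha_t(h)}(f)$, a derivative in the norm of $L(\mathscr A^{\otimes n},\mathscr A)$. *Face maps.* For $0\le j\le n$ let $\boldsymbol\delta^{(j,n)}(f)(x_0,\dots,x_{n+1})$ be the divided difference of $f$ in its $j$-th argument, $$\frac{f(x_0,\dots,x_{j-1},x_j,x_{j+2},\dots,x_{n+1})-f(x_0,\dots,x_{j-1},x_{j+1},x_{j+2},\dots,x_{n+1})}{x_j-x_{j+1}},$$ read as the partial derivative of $f$ in its $j$-th argument, evaluated at $(x_0,\dots,x_j,x_{j+2},\dots,x_{n+1})$, when $x_j=x_{j+1}$. For $a\in\mathscr A$ let $a_{(j,n)}:\mathscr A^{\otimes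 n}\to\mathscr A^{\otimes n+1}$ be the insertion $\rho_1\otimes\cdots\otimes\rho_n\mapsto\rho_1\otimes\cdots\otimes\rho_j\otimes a\otimes\rho_{j+1}\otimes\cdots\otimes\rho_n$. **Proposition.** Let $f\in\mathcal C_{\mathrm{Spec}}(n,h)$. Then $\mathscr S_h(f)$ is well defined (a function $g$ as above exists, and the operator does not depend on its choice), $\boldsymbol\delta^{(j,n)}(f)\in\mathcal C_{\mathrm{Spec}}(n+1,h)$ for $0\le j\le n$, the derivative $\nabla(\mathscr S_h(f))$ exists, and $$\nabla(\mathscr S_h(f))=\sum_{j=0}^n\mathscr S_h\big(\boldsymbol\delta^{(j,n)}(f)\big)\circ(\nabla h)_{(j,n)} .$$ -/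

import Mathlib

open MeasureTheory Filter Topology
open scoped TensorProduct ContDiff

noncomputable section

namespace Rearrangement

section OneSpectralElement

variable {A : Type*} [CStarAlgebra A]

/-- The bounded multilinear map
`(ρ₁, …, ρₙ) ↦ e^{i ξ₀ h} ρ₁ e^{i ξ₁ h} ⋯ ρₙ e^{i ξₙ h}`. -/
def expMultilinear (h : A) (n : ℕ) (ξ : Fin (n + 1) → ℝ) :
    ContinuousMultilinearMap ℂ (fun _ : Fin n => A) A :=
  (ContinuousLinearMap.mul ℂ A
      (NormedSpace.exp ((Complex.I * (ξ 0 : ℂ)) • h))).compContinuousMultilinearMap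
    ((ContinuousMultilinearMap.mkPiAlgebraFin ℂ n A).compContinuousLinearMap fun k : Fin n =>
      (ContinuousLinearMap.mul ℂ A).flip
        (NormedSpace.exp ((Complex.I * (ξ k.succ : ℂ)) • h)))

theorem expMultilinear_apply (h : A) (n : ℕ) (ξ : Fin (n + 1) → ℝ) (ρ : Fin n → A) :
    expMultilinear h n ξ ρ =
      NormedSpace.exp ((Complex.I * (ξ 0 : ℂ)) • h) *
        (List.ofFn fun k : Fin n =>
          ρ k * NormedSpace.exp ((Complex.I * (ξ k.succ : ℂ)) • h)).prod := by
  simp [expMultilinear, ContinuousMultilinearMap.mkPiAlgebraFin_apply]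

/-- `L(A^{⊗ n}, A)`: the bounded operators `A^{⊗ n} → A`, where the algebraic tensor power
carries the projective tensor (semi)norm, so that they are exactly the bounded multilinear maps
in `n` variables. It is a Banach space under the operator norm. -/
def Op (A : Type*) [CStarAlgebra A] (n : ℕ) : Type _ := (⨂[ℂ] _ : Fin n, A) →L[ℂ] A

/-- An element of `L(A^{⊗ n}, A)` as a continuous linear map. -/
def Op.toCLM {n : ℕ} (T : Op A n) : (⨂[ℂ] _ : Fin n, A) →L[ℂ] A := T

instance instNormedAddCommGroupOp (n : ℕ) : NormedAddCommGroup (Op A n) :=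
  @NormedAddCommGroup.ofSeparation (Op A n)
    (inferInstanceAs (SeminormedAddCommGroup ((⨂[ℂ] _ : Fin n, A) →L[ℂ] A)))
    fun {f : (⨂[ℂ] _ : Fin n, A) →L[ℂ] A} hf => by
      refine ContinuousLinearMap.ext fun x => ?_
      have hx := f.le_opNorm x
      have hf' : ‖f‖ = 0 := hf
      rw [hf', zero_mul] at hx
      exact norm_le_zero_iff.1 hx

instance instNormedSpaceOp (n : ℕ) : NormedSpace ℂ (Op A n) :=
  inferInstanceAs (NormedSpace ℂ ((⨂[ℂ] _ : Fin n, A) →L[ℂ] A))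

/-- The isometric identification of bounded multilinear maps in `n` variables with `L(A^{⊗ n}, A)`,
determined by `ρ₁ ⊗ ⋯ ⊗ ρₙ ↦ T (ρ₁, …, ρₙ)`. -/
def opOfMultilinear (A : Type*) [CStarAlgebra A] (n : ℕ) :
    ContinuousMultilinearMap ℂ (fun _ : Fin n => A) A ≃ₗᵢ[ℂ] Op A n :=
  PiTensorProduct.liftIsometry ℂ (fun _ : Fin n => A) A

theorem opOfMultilinear_tprod (n : ℕ) (T : ContinuousMultilinearMap ℂ (fun _ : Fin n => A) A)
    (ρ : Fin n → A) :
    (opOfMultilinear A n T).toCLM (PiTensorProduct.tprod ℂ ρ) = T ρ := by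
  exact (PiTensorProduct.liftIsometry_apply_apply T _).trans (by simp)

instance instCompleteSpaceOp (n : ℕ) : CompleteSpace (Op A n) :=
  (opOfMultilinear A n).toIsometryEquiv.completeSpace_iff.1 inferInstance

/-- `e^{i ξ₀ h^{(0)}} ⋯ e^{i ξₙ h^{(n)}}`, the operator
`ρ₁ ⊗ ⋯ ⊗ ρₙ ↦ e^{i ξ₀ h} ρ₁ e^{i ξ₁ h} ⋯ ρₙ e^{i ξₙ h}`. -/
def expOp (h : A) (n : ℕ) (ξ : Fin (n + 1) → ℝ) : Op A n :=
  opOfMultilinear A n (expMultilinear h n ξ)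

/-- The Fourier transform normalised so that
`f x = ∫ ξ, fourierCoeff n f ξ * exp (i x · ξ)`. -/
def fourierCoeff (n : ℕ) (f : (Fin (n + 1) → ℝ) → ℂ) (ξ : Fin (n + 1) → ℝ) : ℂ :=
  (((2 * Real.pi) ^ (n + 1) : ℝ) : ℂ)⁻¹ *
    ∫ x : Fin (n + 1) → ℝ, f x * Complex.exp (-(Complex.I * ((∑ k, x k * ξ k : ℝ) : ℂ)))

/-- The Schwartz functional calculus integral
`∫ f̂(ξ) e^{i ξ₀ h^{(0)}} ⋯ e^{i ξₙ h^{(n)}} dξ`, a Bochner integral in the Banach space of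
bounded operators `A^{⊗ n} → A`. It is meant for smooth compactly supported `f`. -/
def schwartzIntegral (h : A) (n : ℕ) (f : (Fin (n + 1) → ℝ) → ℂ) : Op A n :=
  ∫ ξ : Fin (n + 1) → ℝ, fourierCoeff n f ξ • expOp h n ξ

/-- `Spec(h)^{n+1}` as a subset of `ℝ^{n+1}`. -/
def specCube (h : A) (n : ℕ) : Set (Fin (n + 1) → ℝ) :=
  Set.univ.pi fun _ => spectrum ℝ h

/-- Spectral functions with `n + 1` arguments: smooth on `U × ⋯ × U` for some open `U ⊆ ℝ`
containing the spectrum of `h`. -/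
def CSpec (h : A) (n : ℕ) : Set ((Fin (n + 1) → ℝ) → ℂ) :=
  {f | ∃ U : Set ℝ, IsOpen U ∧ spectrum ℝ h ⊆ U ∧
    ContDiffOn ℝ ∞ f (Set.univ.pi fun _ : Fin (n + 1) => U)}

/-- `g` is a smooth compactly supported function on `ℝ^{n+1}` that coincides with `f` on a
neighbourhood of `Spec(h)^{n+1}`. -/
structure IsLocalization (h : A) (n : ℕ) (f g : (Fin (n + 1) → ℝ) → ℂ) : Prop where
  contDiff : ContDiff ℝ ∞ g
  hasCompactSupport : HasCompactSupport g
  eventuallyEq : g =ᶠ[𝓝ˢ (specCube h n)] f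

open Classical in
/-- The rearrangement operator `𝒮_h(f) = f(h^{(0)}, …, h^{(n)}) : A^{⊗ n} → A`: the Schwartz
functional calculus integral of a smooth compactly supported function that agrees with `f`
near `Spec(h)^{n+1}`. -/
def rearr (h : A) (n : ℕ) (f : (Fin (n + 1) → ℝ) → ℂ) : Op A n :=
  if hf : ∃ g, IsLocalization h n f g then schwartzIntegral h n hf.choose else 0

/-- The operator `A^{⊗ n} → A^{⊗ (n+1)}` that inserts `a` in the `j`-th slot:
`ρ₁ ⊗ ⋯ ⊗ ρₙ ↦ ρ₁ ⊗ ⋯ ⊗ ρⱼ ⊗ a ⊗ ρⱼ₊₁ ⊗ ⋯ ⊗ ρₙ`, `0 ≤ j ≤ n`. -/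
def insertSlot (n : ℕ) (j : Fin (n + 1)) (a : A) :
    (⨂[ℂ] _ : Fin n, A) →L[ℂ] (⨂[ℂ] _ : Fin (n + 1), A) :=
  PiTensorProduct.liftIsometry ℂ (fun _ : Fin n => A) (⨂[ℂ] _ : Fin (n + 1), A)
    { toMultilinearMap :=
        MultilinearMap.curryMid j (PiTensorProduct.tprod ℂ (s := fun _ : Fin (n + 1) => A)) a
      cont := by
        have h1 : Continuous fun ρ : Fin n → A =>
            PiTensorProduct.tprodL ℂ (E := fun _ : Fin (n + 1) => A)
              (j.insertNth (α := fun _ => A) a ρ) :=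
          (PiTensorProduct.tprodL ℂ (E := fun _ : Fin (n + 1) => A)).cont.comp
            (continuous_const.finInsertNth j continuous_id)
        exact h1 }

theorem insertSlot_tprod (n : ℕ) (j : Fin (n + 1)) (a : A) (ρ : Fin n → A) :
    insertSlot n j a (PiTensorProduct.tprod ℂ ρ) =
      PiTensorProduct.tprod ℂ (j.insertNth (α := fun _ => A) a ρ) := by
  simp [insertSlot]

/-- The composition `T ∘ a_{(j,n)}` of an operator `T : A^{⊗ (n+1)} → A` with the insertion of `a`
in the `j`-th slot. -/
def Op.compInsertSlot {n : ℕ} (T : Op A (n + 1)) (j : Fin (n + 1)) (a : A) : Op A n :=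
  T.toCLM.comp (insertSlot n j a)

theorem Op.compInsertSlot_tprod {n : ℕ} (T : Op A (n + 1)) (j : Fin (n + 1)) (a : A)
    (ρ : Fin n → A) :
    (T.compInsertSlot j a).toCLM (PiTensorProduct.tprod ℂ ρ) =
      T.toCLM (PiTensorProduct.tprod ℂ (j.insertNth (α := fun _ => A) a ρ)) :=
  congrArg T.toCLM (insertSlot_tprod n j a ρ)

end OneSpectralElement

/-- The face map `δ^{(j,n)}`: the divided difference in the `j`-th argument,
`f (x₀, …, xⱼ₋₁, •, xⱼ₊₂, …, xₙ₊₁) [xⱼ, xⱼ₊₁]`. For `xⱼ = xⱼ₊₁` it is the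
partial derivative in the `j`-th argument. -/
def face (n : ℕ) (j : Fin (n + 1)) (f : (Fin (n + 1) → ℝ) → ℂ) :
    (Fin (n + 2) → ℝ) → ℂ := fun x =>
  dslope (fun z : ℝ => f (Function.update (fun k => x (j.succ.succAbove k)) j z))
    (x j.castSucc) (x j.succ)

section Derivation

variable {A : Type*} [CStarAlgebra A]

/-- The derivation `∇ a = d/dt|_{t=0} α_t(a)` of a one-parameter group of automorphisms;
meaningful where the derivative exists. -/
def nabla (α : Multiplicative ℝ →* (A ≃⋆ₐ[ℂ] A)) (a : A) : A :=
  deriv (fun t : ℝ => α (Multiplicative.ofAdd t) a) 0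

/-- `∇ (𝒮_h(f)) = d/dt|_{t=0} 𝒮_{α_t(h)}(f)`, the derivative being taken in the norm of
`L(A^{⊗ n}, A)`. -/
def nablaRearr (α : Multiplicative ℝ →* (A ≃⋆ₐ[ℂ] A)) (h : A) (n : ℕ)
    (f : (Fin (n + 1) → ℝ) → ℂ) : Op A n :=
  deriv (fun t : ℝ => rearr (α (Multiplicative.ofAdd t) h) n f) 0

end Derivation

end Rearrangement

end

/-! Both sides are superpositions of the operators `expOp`, and they agree because an exponential is
differentiated in the same way on the operator side and on the function side. Let `g` localize `f`.
Automorphisms preserve the spectrum, so the same `g` serves for every `α_t(h)`. Duhamel's formula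
differentiates the j-th exponential in the direction a = ∇h to ∫₀¹ iξⱼ e^{isξⱼh} a e^{i(1-s)ξⱼh} ds,
which is `expOp` at the frequencies `splitFreq` with a inserted between the two halves
(`compInsertSlot_expOp_splitFreq`). The exponentials are unitary, so the difference quotients are
O(‖ξ‖). The transform of `g` has a finite first moment, and dominated convergence gives the
derivative (`hasDerivAt_schwartzIntegral`).

On the function side the divided difference is the average of ∂ⱼg over a segment. Fourier inversion
then writes the face of `g` as a superposition of exponentials with the same density ĝ(ξ) iξⱼ and
the same split frequencies (`face_eq_superposition`).

This face need not have compact support, so it must be cut off. The bridge is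
`schwartzIntegral_tensorPower_mul_superposition`: if φ = 1 on the spectrum, the calculus of φ⊗⋯⊗φ
times a superposition of exponentials is the superposition of the exponential operators. Fubini
reduces this to one variable, where φ(h) = 1 by the continuous functional calculus. Applied to the
inversion formula of `g` itself, it also yields independence of the localization. -/

namespace Rearrangement

/-! ### Fourier inversion for Schwartz functions in angular frequency. -/

section FourierInversion

open scoped FourierTransform RealInnerProductSpace SchwartzMap

variable {V : Type*} [NormedAddCommGroup V] [InnerProductSpace ℝ V] [FiniteDimensional ℝ V]
  [MeasurableSpace V] [BorelSpace V]

/-- The Fourier transform of a Schwartz function, with the normalisation in which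
`f x = ∫ ξ, angularFourier f ξ * exp (i ⟪x, ξ⟫)`. -/
noncomputable def angularFourier (S : 𝓢(V, ℂ)) (ξ : V) : ℂ :=
  (((2 * Real.pi) ^ Module.finrank ℝ V : ℝ) : ℂ)⁻¹ * 𝓕 S ((2 * Real.pi)⁻¹ • ξ)

theorem angularFourier_eq_integral (S : 𝓢(V, ℂ)) (ξ : V) :
    angularFourier S ξ = (((2 * Real.pi) ^ Module.finrank ℝ V : ℝ) : ℂ)⁻¹ *
      ∫ x : V, S x * Complex.exp (-(Complex.I * ((⟪x, ξ⟫ : ℝ) : ℂ))) := by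
  rw [angularFourier, SchwartzMap.fourier_coe, Real.fourier_eq']
  congr 1
  refine integral_congr_ae (Eventually.of_forall fun x => ?_)
  have hpi : (2 * Real.pi : ℝ) ≠ 0 := by positivity
  simp only [smul_eq_mul, inner_smul_right]
  rw [mul_comm]
  congr 2
  rw [show -2 * Real.pi * ((2 * Real.pi)⁻¹ * ⟪x, ξ⟫) = -⟪x, ξ⟫ by field_simp]
  push_cast
  ring

theorem continuous_angularFourier (S : 𝓢(V, ℂ)) : Continuous (angularFourier S) :=
  continuous_const.mul ((𝓕 S).continuous.comp (continuous_const_smul _))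

/-- Only two moments matter later: k = 0 for absolute convergence of the calculus, k = 1 for
differentiating it. -/
theorem integrable_pow_mul_angularFourier (S : 𝓢(V, ℂ)) (k : ℕ) :
    Integrable fun ξ : V => ‖ξ‖ ^ k * ‖angularFourier S ξ‖ := by
  have hpi : (0 : ℝ) < 2 * Real.pi := by positivity
  have h := ((𝓕 S).integrable_pow_mul volume k).comp_smul (inv_ne_zero hpi.ne')
  refine (h.const_mul ((2 * Real.pi) ^ k * ((2 * Real.pi) ^ Module.finrank ℝ V)⁻¹)).congr
    (Eventually.of_forall fun ξ => ?_)
  beta_reduce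
  rw [angularFourier, norm_mul, norm_inv, norm_smul, Complex.norm_real, norm_inv,
    Real.norm_of_nonneg hpi.le, Real.norm_of_nonneg (pow_nonneg hpi.le _), mul_pow _ ‖ξ‖, inv_pow]
  have := pow_pos hpi k
  field_simp

theorem integral_angularFourier_mul_exp (S : 𝓢(V, ℂ)) (x : V) :
    ∫ ξ : V, angularFourier S ξ * Complex.exp (Complex.I * ((⟪x, ξ⟫ : ℝ) : ℂ)) = S x := by
  have hpi : (0 : ℝ) < 2 * Real.pi := by positivity
  have h1 : 𝓕⁻ ((𝓕 S : 𝓢(V, ℂ)) : V → ℂ) x = S x := by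
    rw [← SchwartzMap.fourierInv_coe, FourierTransform.fourierInv_fourier_eq]
  rw [Real.fourierInv_eq'] at h1
  have h2 := Measure.integral_comp_inv_smul_of_nonneg volume
    (fun ξ : V => Complex.exp (((2 * Real.pi * ⟪ξ, x⟫ : ℝ) : ℂ) * Complex.I) • 𝓕 S ξ) hpi.le
  rw [h1] at h2
  have h3 : ∀ ξ : V, angularFourier S ξ * Complex.exp (Complex.I * ((⟪x, ξ⟫ : ℝ) : ℂ)) =
      (((2 * Real.pi) ^ Module.finrank ℝ V : ℝ) : ℂ)⁻¹ *
        (Complex.exp (((2 * Real.pi * ⟪(2 * Real.pi)⁻¹ • ξ, x⟫ : ℝ) : ℂ) * Complex.I) •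
          𝓕 S ((2 * Real.pi)⁻¹ • ξ)) := by
    intro ξ
    rw [angularFourier, inner_smul_left, real_inner_comm x ξ]
    rw [show 2 * Real.pi * ((starRingEnd ℝ) (2 * Real.pi)⁻¹ * ⟪x, ξ⟫) = ⟪x, ξ⟫ by
      simp only [conj_trivial]; field_simp]
    rw [smul_eq_mul, mul_comm Complex.I]
    ring
  simp_rw [h3]
  rw [integral_const_mul, h2, Complex.real_smul, ← mul_assoc, inv_mul_cancel₀, one_mul]
  exact_mod_cast (pow_pos hpi _).ne'

end FourierInversion

/-! ### Transfer from Euclidean space to the sup-normed coordinate space. -/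

section FourierCoeff

open scoped FourierTransform RealInnerProductSpace SchwartzMap

variable {n : ℕ} {g : (Fin (n + 1) → ℝ) → ℂ}

/-- A smooth compactly supported function on `ℝ^{n+1}` as a Schwartz function on Euclidean
space. -/
noncomputable def euclideanSchwartz (hg : ContDiff ℝ ∞ g) (hc : HasCompactSupport g) :
    𝓢(EuclideanSpace ℝ (Fin (n + 1)), ℂ) :=
  HasCompactSupport.toSchwartzMap
    (f := g ∘ (EuclideanSpace.equiv (Fin (n + 1)) ℝ).toHomeomorph)
    (hc.comp_homeomorph _) (hg.comp (EuclideanSpace.equiv (Fin (n + 1)) ℝ).contDiff)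

theorem euclideanSchwartz_apply (hg : ContDiff ℝ ∞ g) (hc : HasCompactSupport g)
    (x : EuclideanSpace ℝ (Fin (n + 1))) : euclideanSchwartz hg hc x = g x.ofLp := rfl

theorem inner_toLp_eq_sum (x ξ : Fin (n + 1) → ℝ) :
    (⟪WithLp.toLp 2 x, WithLp.toLp 2 ξ⟫ : ℝ) = ∑ k, x k * ξ k := by
  simp [PiLp.inner_apply, mul_comm]

theorem integral_toLp {E : Type*} [NormedAddCommGroup E] [NormedSpace ℝ E]
    (F : EuclideanSpace ℝ (Fin (n + 1)) → E) :
    ∫ x : Fin (n + 1) → ℝ, F (WithLp.toLp 2 x) = ∫ x, F x :=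
  (PiLp.volume_preserving_toLp (Fin (n + 1))).integral_comp
    (MeasurableEquiv.toLp 2 (Fin (n + 1) → ℝ)).measurableEmbedding F

/-- The coordinate space with its sup norm has no inner product; the change of norm preserves
Lebesgue measure, so inversion and decay carry over. -/
theorem fourierCoeff_eq_angularFourier (hg : ContDiff ℝ ∞ g) (hc : HasCompactSupport g)
    (ξ : Fin (n + 1) → ℝ) :
    fourierCoeff n g ξ = angularFourier (euclideanSchwartz hg hc) (WithLp.toLp 2 ξ) := by
  rw [angularFourier_eq_integral, fourierCoeff, finrank_euclideanSpace_fin, ← integral_toLp]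
  simp only [inner_toLp_eq_sum, euclideanSchwartz_apply]

theorem continuous_fourierCoeff (hg : ContDiff ℝ ∞ g) (hc : HasCompactSupport g) :
    Continuous (fourierCoeff n g) := by
  rw [funext (fourierCoeff_eq_angularFourier hg hc)]
  exact (continuous_angularFourier _).comp (PiLp.continuous_toLp 2 _)

theorem integral_fourierCoeff_mul_exp (hg : ContDiff ℝ ∞ g) (hc : HasCompactSupport g)
    (x : Fin (n + 1) → ℝ) :
    ∫ ξ, fourierCoeff n g ξ * Complex.exp (Complex.I * ((∑ k, x k * ξ k : ℝ) : ℂ)) = g x := by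
  have h := integral_angularFourier_mul_exp (euclideanSchwartz hg hc) (WithLp.toLp 2 x)
  rw [← integral_toLp] at h
  simpa only [inner_toLp_eq_sum, ← fourierCoeff_eq_angularFourier, euclideanSchwartz_apply] using h

theorem integrable_norm_fourierCoeff_comp (hg : ContDiff ℝ ∞ g) (hc : HasCompactSupport g) (k : ℕ) :
    Integrable fun ξ : Fin (n + 1) → ℝ => ‖WithLp.toLp 2 ξ‖ ^ k * ‖fourierCoeff n g ξ‖ := by
  have h := ((PiLp.volume_preserving_toLp (Fin (n + 1))).integrable_comp_emb
    (MeasurableEquiv.toLp 2 (Fin (n + 1) → ℝ)).measurableEmbedding).2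
    (integrable_pow_mul_angularFourier (euclideanSchwartz hg hc) k)
  simpa only [Function.comp_def, ← fourierCoeff_eq_angularFourier] using h

theorem integrable_fourierCoeff (hg : ContDiff ℝ ∞ g) (hc : HasCompactSupport g) :
    Integrable (fourierCoeff n g) := by
  rw [← integrable_norm_iff (continuous_fourierCoeff hg hc).aestronglyMeasurable]
  simpa using integrable_norm_fourierCoeff_comp hg hc 0

/-- This first moment dominates the difference quotients of `expOp` in `h`, which grow linearly in
ξ. -/
theorem integrable_norm_mul_fourierCoeff (hg : ContDiff ℝ ∞ g) (hc : HasCompactSupport g) :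
    Integrable fun ξ : Fin (n + 1) → ℝ => ‖ξ‖ * ‖fourierCoeff n g ξ‖ := by
  refine (integrable_norm_fourierCoeff_comp hg hc 1).mono'
    ((continuous_norm.mul (continuous_fourierCoeff hg hc).norm).aestronglyMeasurable)
    (Eventually.of_forall fun ξ => ?_)
  rw [pow_one, norm_mul, norm_norm, norm_norm]
  refine mul_le_mul_of_nonneg_right ?_ (norm_nonneg _)
  exact (pi_norm_le_iff_of_nonneg (norm_nonneg _)).2 fun i =>
    PiLp.norm_apply_le (WithLp.toLp 2 ξ) i

end FourierCoeff

/-! ### Exponentials of self-adjoint elements and Duhamel's formula. -/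

section OneParameterUnitaryGroup

variable {A : Type*} [CStarAlgebra A]

/-- The exponential `e^{i t h}`. -/
noncomputable def expI (h : A) (t : ℝ) : A := NormedSpace.exp ((Complex.I * (t : ℂ)) • h)

theorem continuous_expI : Continuous fun p : A × ℝ => expI p.1 p.2 := by
  unfold expI
  let _ : NormedAlgebra ℚ A := NormedAlgebra.restrictScalars ℚ ℂ A
  have : Continuous (NormedSpace.exp : A → A) := NormedSpace.exp_continuous
  fun_prop

theorem _root_.Continuous.expI {X : Type*} [TopologicalSpace X] {f : X → A} {t : X → ℝ}
    (hf : Continuous f) (ht : Continuous t) : Continuous fun x => Rearrangement.expI (f x) (t x) :=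
  continuous_expI.comp (hf.prodMk ht)

@[simp]
theorem expI_zero (h : A) : expI h 0 = 1 := by simp [expI]

theorem norm_expI_le_one {h : A} (hsa : IsSelfAdjoint h) (t : ℝ) : ‖expI h t‖ ≤ 1 := by
  have hth : IsSelfAdjoint ((t : ℝ) • h) := (IsSelfAdjoint.all t).smul hsa
  have h1 : expI h t = ((selfAdjoint.expUnitary ⟨t • h, hth⟩ : unitary A) : A) := by
    rw [selfAdjoint.expUnitary_coe, expI, mul_smul]
    rfl
  rw [h1]
  -- In the zero algebra a unitary has norm 0 instead of 1, hence the case split.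
  rcases subsingleton_or_nontrivial A with hA | hA
  · rw [Subsingleton.elim ((selfAdjoint.expUnitary ⟨t • h, hth⟩ : unitary A) : A) 0]
    simp
  · exact (CStarRing.norm_coe_unitary _).le

theorem hasDerivAt_expI (h : A) (t : ℝ) :
    HasDerivAt (expI h) (Complex.I • (expI h t * h)) t := by
  have h1 := hasDerivAt_exp_smul_const (𝕂 := ℝ) (Complex.I • h) t
  have h2 : ∀ u : ℝ, NormedSpace.exp (u • (Complex.I • h)) = expI h u := by
    intro u
    rw [expI, mul_comm, mul_smul]
    rfl
  simp only [h2] at h1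
  convert h1 using 1
  simp

theorem hasDerivAt_expI' (h : A) (t : ℝ) :
    HasDerivAt (expI h) (Complex.I • (h * expI h t)) t := by
  have h1 := hasDerivAt_exp_smul_const' (𝕂 := ℝ) (Complex.I • h) t
  have h2 : ∀ u : ℝ, NormedSpace.exp (u • (Complex.I • h)) = expI h u := by
    intro u
    rw [expI, mul_comm, mul_smul]
    rfl
  simp only [h2] at h1
  convert h1 using 1
  simp

/-- Duhamel's formula. -/
theorem expI_sub_expI (a b : A) (t : ℝ) :
    expI b t - expI a t = ∫ s in (0 : ℝ)..1,
      (Complex.I * (t : ℂ)) • (expI b (s * t) * (b - a) * expI a ((1 - s) * t)) := by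
  -- The path runs from e^{ita} at s = 0 to e^{itb} at s = 1. Differentiating the left factor with b
  -- on its right and the right factor with a on its left puts b - a in the middle.
  have hd : ∀ s : ℝ, HasDerivAt (fun s : ℝ => expI b (s * t) * expI a ((1 - s) * t))
      ((Complex.I * (t : ℂ)) • (expI b (s * t) * (b - a) * expI a ((1 - s) * t))) s := by
    intro s
    have h1 := (hasDerivAt_expI b (s * t)).scomp s ((hasDerivAt_id s).mul_const t)
    have h2 := (hasDerivAt_expI' a ((1 - s) * t)).scomp s
      (((hasDerivAt_id s).const_sub 1).mul_const t)
    refine (h1.mul h2).congr_deriv ?_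
    simp only [Function.comp_apply, id, one_mul, neg_mul, neg_smul, mul_neg, mul_smul,
      smul_mul_assoc, mul_smul_comm, mul_sub, sub_mul, smul_sub, mul_assoc, ← sub_eq_add_neg]
    rw [smul_comm Complex.I (t : ℂ), smul_comm Complex.I (t : ℂ)]
    rfl
  have hc : Continuous fun s : ℝ =>
      (Complex.I * (t : ℂ)) • (expI b (s * t) * (b - a) * expI a ((1 - s) * t)) :=
    (((continuous_const.expI (by fun_prop)).mul continuous_const).mul
      (continuous_const.expI (by fun_prop))).const_smul _
  rw [intervalIntegral.integral_eq_sub_of_hasDerivAt (fun s _ => hd s) (hc.intervalIntegrable _ _)]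
  simp

theorem norm_expI_mul_mul_expI_le {a b : A} (ha : IsSelfAdjoint a) (hb : IsSelfAdjoint b) (c : A)
    (s t : ℝ) : ‖expI a s * c * expI b t‖ ≤ ‖c‖ := by
  refine (norm_mul_le _ _).trans ?_
  refine (mul_le_mul (norm_mul_le _ _) (norm_expI_le_one hb t) (norm_nonneg _) (by positivity)).trans
    ?_
  rw [mul_one]
  exact mul_le_of_le_one_left (norm_nonneg _) (norm_expI_le_one ha s)

/-- All factors in Duhamel's integrand other than b - a and the scalar it are contractions, by
self-adjointness; this keeps the growth in t linear. -/
theorem norm_expI_sub_expI_le {a b : A} (ha : IsSelfAdjoint a) (hb : IsSelfAdjoint b) (t : ℝ) :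
    ‖expI b t - expI a t‖ ≤ |t| * ‖b - a‖ := by
  rw [expI_sub_expI]
  refine (intervalIntegral.norm_integral_le_of_norm_le_const (C := |t| * ‖b - a‖)
    fun s _ => ?_).trans (by simp)
  rw [norm_smul]
  simp only [norm_mul, Complex.norm_I, one_mul, Complex.norm_real, Real.norm_eq_abs]
  exact mul_le_mul_of_nonneg_left (norm_expI_mul_mul_expI_le hb ha _ _ _) (abs_nonneg _)

/-- Duhamel's formula turns the difference quotient exactly into an integral with the slope of γ in
the middle, so differentiability of γ at the single point u suffices. Contractivity of the outer
factors gives the dominating constant. -/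
theorem hasDerivAt_expI_comp {γ : ℝ → A} {a : A} {u : ℝ} (hγ : HasDerivAt γ a u)
    (hsa : ∀ v, IsSelfAdjoint (γ v)) (t : ℝ) :
    HasDerivAt (fun v => expI (γ v) t)
      (∫ s in (0 : ℝ)..1,
        (Complex.I * (t : ℂ)) • (expI (γ u) (s * t) * a * expI (γ u) ((1 - s) * t))) u := by
  rw [hasDerivAt_iff_tendsto_slope] at hγ ⊢
  have hslope : slope (fun v => expI (γ v) t) u = fun v => ∫ s in (0 : ℝ)..1,
      (Complex.I * (t : ℂ)) • (expI (γ v) (s * t) * slope γ u v * expI (γ u) ((1 - s) * t)) := by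
    funext v
    rw [slope_def_module, expI_sub_expI, ← intervalIntegral.integral_smul]
    congr 1
    funext s
    rw [slope_def_module, smul_comm, mul_smul_comm, smul_mul_assoc]
  rw [hslope]
  have hcont : Tendsto γ (𝓝[≠] u) (𝓝 (γ u)) :=
    (hasDerivAt_iff_tendsto_slope.2 hγ).continuousAt.tendsto.mono_left nhdsWithin_le_nhds
  refine intervalIntegral.tendsto_integral_filter_of_dominated_convergence
    (fun _ => |t| * (‖a‖ + 1)) ?_ ?_ ?_ ?_
  · refine Eventually.of_forall fun v => Continuous.aestronglyMeasurable ?_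
    exact (((continuous_const.expI (by fun_prop)).mul continuous_const).mul
      (continuous_const.expI (by fun_prop))).const_smul _
  · have : ∀ᶠ v in 𝓝[≠] u, ‖slope γ u v‖ < ‖a‖ + 1 :=
      hγ.norm.eventually (gt_mem_nhds (lt_add_one _))
    filter_upwards [this] with v hv
    refine Eventually.of_forall fun s _ => ?_
    rw [norm_smul]
    simp only [norm_mul, Complex.norm_I, one_mul, Complex.norm_real, Real.norm_eq_abs]
    exact mul_le_mul_of_nonneg_left
      ((norm_expI_mul_mul_expI_le (hsa v) (hsa u) _ _ _).trans hv.le) (abs_nonneg _)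
  · exact intervalIntegrable_const
  · refine Eventually.of_forall fun s _ => ?_
    have h1 : Tendsto (fun v => expI (γ v) (s * t)) (𝓝[≠] u) (𝓝 (expI (γ u) (s * t))) :=
      ((continuous_id.expI continuous_const).tendsto (γ u)).comp hcont
    exact ((h1.mul hγ).mul tendsto_const_nhds).const_smul _

end OneParameterUnitaryGroup

/-! ### The exponential operators as values of a fixed bounded multilinear map. -/

section SlotMultilinear

variable {A : Type*} [CStarAlgebra A]

/-- The operator `ρ₁ ⊗ ⋯ ⊗ ρₙ ↦ v₀ ρ₁ v₁ ⋯ ρₙ vₙ` as a multilinear function of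
`(v₀, …, vₙ)`, with values in bounded multilinear maps. -/
noncomputable def sandwichAux (A : Type*) [CStarAlgebra A] (n : ℕ) :
    ContinuousMultilinearMap ℂ (fun _ : Fin n => A)
      (ContinuousMultilinearMap ℂ (fun _ : Fin n => A) A) :=
  ((ContinuousLinearMap.apply ℂ (ContinuousMultilinearMap ℂ (fun _ : Fin n => A) A)
      (ContinuousMultilinearMap.mkPiAlgebraFin ℂ n A)).compContinuousMultilinearMap
    (ContinuousMultilinearMap.compContinuousLinearMapContinuousMultilinear ℂ
      (fun _ : Fin n => A) (fun _ : Fin n => A) A)).compContinuousLinearMap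
    fun _ => (ContinuousLinearMap.mul ℂ A).flip

/-- The multilinear map `(v₀, …, vₙ) ↦ B v₀ (T (v₁, …, vₙ))`. -/
noncomputable def consMultilinear {E F G : Type*} [NormedAddCommGroup E] [NormedSpace ℂ E]
    [NormedAddCommGroup F] [NormedSpace ℂ F] [NormedAddCommGroup G] [NormedSpace ℂ G] {n : ℕ}
    (B : E →L[ℂ] F →L[ℂ] G) (T : ContinuousMultilinearMap ℂ (fun _ : Fin n => E) F) :
    ContinuousMultilinearMap ℂ (fun _ : Fin (n + 1) => E) G :=
  ContinuousLinearMap.uncurryLeft (Ei := fun _ : Fin (n + 1) => E)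
    (((ContinuousLinearMap.compContinuousMultilinearMapL ℂ (fun _ : Fin n => E) F G).flip T).comp B)

theorem consMultilinear_apply {E F G : Type*} [NormedAddCommGroup E] [NormedSpace ℂ E]
    [NormedAddCommGroup F] [NormedSpace ℂ F] [NormedAddCommGroup G] [NormedSpace ℂ G] {n : ℕ}
    (B : E →L[ℂ] F →L[ℂ] G) (T : ContinuousMultilinearMap ℂ (fun _ : Fin n => E) F)
    (v : Fin (n + 1) → E) : consMultilinear B T v = B (v 0) (T (Fin.tail v)) := by
  simp [consMultilinear]

/-- Left multiplication of the values of a bounded multilinear map by an element of the algebra. -/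
noncomputable def mulLeftMultilinear (A : Type*) [CStarAlgebra A] (n : ℕ) :
    A →L[ℂ] ContinuousMultilinearMap ℂ (fun _ : Fin n => A) A →L[ℂ]
      ContinuousMultilinearMap ℂ (fun _ : Fin n => A) A :=
  (ContinuousLinearMap.compContinuousMultilinearMapL ℂ (fun _ : Fin n => A) A A).comp
    (ContinuousLinearMap.mul ℂ A)

/-- The operator `ρ₁ ⊗ ⋯ ⊗ ρₙ ↦ v₀ ρ₁ v₁ ⋯ ρₙ vₙ`, as a bounded multilinear function of
`(v₀, …, vₙ)`. -/
noncomputable def sandwich (A : Type*) [CStarAlgebra A] (n : ℕ) :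
    ContinuousMultilinearMap ℂ (fun _ : Fin (n + 1) => A) (Op A n) :=
  ((opOfMultilinear A n).toContinuousLinearEquiv.toContinuousLinearMap).compContinuousMultilinearMap
    (consMultilinear (mulLeftMultilinear A n) (sandwichAux A n))

theorem sandwich_tprod (n : ℕ) (v : Fin (n + 1) → A) (ρ : Fin n → A) :
    (sandwich A n v).toCLM (PiTensorProduct.tprod ℂ ρ) =
      v 0 * (List.ofFn fun k : Fin n => ρ k * v k.succ).prod := by
  refine (opOfMultilinear_tprod n (consMultilinear (mulLeftMultilinear A n) (sandwichAux A n) v)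
    ρ).trans ?_
  simp [consMultilinear_apply, sandwichAux, mulLeftMultilinear, ContinuousMultilinearMap.mkPiAlgebraFin_apply, Fin.tail]

theorem Op.ext_tprod {n : ℕ} {S T : Op A n}
    (h : ∀ ρ, S.toCLM (PiTensorProduct.tprod ℂ ρ) = T.toCLM (PiTensorProduct.tprod ℂ ρ)) :
    S = T := by
  have h1 : (S.toCLM : (⨂[ℂ] _ : Fin n, A) →ₗ[ℂ] A) = (T.toCLM : (⨂[ℂ] _ : Fin n, A) →ₗ[ℂ] A) :=
    PiTensorProduct.ext (MultilinearMap.ext h)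
  exact (ContinuousLinearMap.coe_injective h1 : S.toCLM = T.toCLM)

/-- All dependence on `h` and ξ now sits in the arguments of one multilinear map, so continuity,
bounds and derivatives reduce to those of single exponentials. -/
theorem expOp_eq_sandwich (h : A) (n : ℕ) (ξ : Fin (n + 1) → ℝ) :
    expOp h n ξ = sandwich A n fun k => expI h (ξ k) := by
  refine Op.ext_tprod fun ρ => ?_
  rw [sandwich_tprod, expOp, opOfMultilinear_tprod, expMultilinear_apply]
  rfl

theorem continuous_expOp (h : A) (n : ℕ) : Continuous (expOp h n) := by
  rw [funext (expOp_eq_sandwich h n)]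
  exact (sandwich A n).cont.comp
    (continuous_pi fun k => continuous_const.expI (continuous_apply k))

theorem norm_expOp_le {h : A} (hsa : IsSelfAdjoint h) (n : ℕ) (ξ : Fin (n + 1) → ℝ) :
    ‖expOp h n ξ‖ ≤ ‖sandwich A n‖ := by
  rw [expOp_eq_sandwich]
  refine ((sandwich A n).le_opNorm _).trans (mul_le_of_le_one_right (norm_nonneg _) ?_)
  exact Finset.prod_le_one (fun _ _ => norm_nonneg _) fun _ _ => norm_expI_le_one hsa _

/-- Changing the n + 1 arguments one at a time costs a factor n + 1, since all of them have norm at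
most 1; each change is bounded by Duhamel. -/
theorem norm_expOp_sub_expOp_le {a b : A} (ha : IsSelfAdjoint a) (hb : IsSelfAdjoint b) (n : ℕ)
    (ξ : Fin (n + 1) → ℝ) :
    ‖expOp b n ξ - expOp a n ξ‖ ≤ ‖sandwich A n‖ * (n + 1 : ℕ) * (‖ξ‖ * ‖b - a‖) := by
  have hle : ∀ {c : A}, IsSelfAdjoint c → ‖fun k => expI c (ξ k)‖ ≤ 1 := fun hc =>
    (pi_norm_le_iff_of_nonneg zero_le_one).2 fun k => norm_expI_le_one hc _
  rw [expOp_eq_sandwich, expOp_eq_sandwich]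
  refine ((sandwich A n).norm_image_sub_le _ _).trans ?_
  rw [Fintype.card_fin]
  have h1 : max ‖fun k => expI b (ξ k)‖ ‖fun k => expI a (ξ k)‖ ^ (n + 1 - 1) ≤ 1 :=
    pow_le_one₀ (le_max_of_le_left (norm_nonneg _)) (max_le (hle hb) (hle ha))
  have h2 : ‖(fun k => expI b (ξ k)) - fun k => expI a (ξ k)‖ ≤ ‖ξ‖ * ‖b - a‖ := by
    refine (pi_norm_le_iff_of_nonneg (by positivity)).2 fun k => ?_
    refine (norm_expI_sub_expI_le ha hb (ξ k)).trans
      (mul_le_mul_of_nonneg_right ?_ (norm_nonneg _))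
    exact norm_le_pi_norm ξ k
  exact mul_le_mul (mul_le_of_le_one_right (by positivity) h1) h2 (norm_nonneg _) (by positivity)

end SlotMultilinear

/-! ### One variable: functions equal to 1 on the spectrum act as the identity. -/

section FunctionalCalculus

open scoped SchwartzMap

variable {A : Type*} [CStarAlgebra A]

theorem expI_eq_cfc {h : A} (hsa : IsSelfAdjoint h) (t : ℝ) :
    expI h t = cfc (fun z : ℂ => Complex.exp (Complex.I * t * z)) h := by
  have hn : IsStarNormal h := hsa.isStarNormal
  have h1 := cfc_comp_smul (Complex.I * (t : ℂ)) Complex.exp h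
  simp only [smul_eq_mul] at h1
  have hn' : IsStarNormal ((Complex.I * (t : ℂ)) • h) := by
    constructor
    simp only [star_smul, hsa.star_eq]
    exact (Commute.refl h).smul_left _ |>.smul_right _
  rw [h1, CFC.complex_exp_eq_normedSpace_exp, expI]

theorem expI_add (h : A) (s t : ℝ) : expI h (s + t) = expI h s * expI h t := by
  let _ : NormedAlgebra ℚ A := NormedAlgebra.restrictScalars ℚ ℂ A
  rw [expI, expI, expI, ← NormedSpace.exp_add_of_commute
    (((Commute.refl h).smul_left _).smul_right _), ← add_smul]
  push_cast
  ring_nf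

/-- The integral passes inside the continuous functional calculus, where Fourier inversion evaluates
it to S(h); and S = 1 on the spectrum. -/
theorem integral_angularFourier_smul_expI {h : A} (hsa : IsSelfAdjoint h) {S : 𝓢(ℝ, ℂ)}
    (h1 : ∀ x ∈ spectrum ℝ h, S x = 1) : ∫ t, angularFourier S t • expI h t = 1 := by
  have hn : IsStarNormal h := hsa.isStarNormal
  -- The functional calculus used is the complex one; self-adjointness makes its spectrum the real
  -- one.
  have hre : ∀ z ∈ spectrum ℂ h, ∃ x ∈ spectrum ℝ h, (x : ℂ) = z := fun z hz => by
    have h2 := hsa.mem_spectrum_eq_re hz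
    refine ⟨z.re, ?_, h2.symm⟩
    rw [h2] at hz
    exact spectrum.of_algebraMap_mem ℂ hz
  have hcfc := cfc_integral (μ := volume) (X := ℝ) (𝕜 := ℂ)
    (fun t z => angularFourier S t * Complex.exp (Complex.I * t * z))
    (fun t => ‖angularFourier S t‖) h ?_ ?_ ?_ hn
  · have h3 : ∀ t : ℝ, cfc (fun z : ℂ => angularFourier S t * Complex.exp (Complex.I * t * z)) h =
        angularFourier S t • expI h t := fun t => by
      rw [cfc_const_mul _ _ h (by fun_prop), expI_eq_cfc hsa]
    simp only [h3] at hcfc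
    rw [← hcfc, ← cfc_one ℂ h]
    refine cfc_congr fun z hz => ?_
    obtain ⟨x, hx, rfl⟩ := hre z hz
    rw [Pi.one_apply, ← h1 x hx, ← integral_angularFourier_mul_exp S x]
    refine integral_congr_ae (Eventually.of_forall fun t => ?_)
    simp [mul_assoc]
  · refine Continuous.continuousOn ?_
    exact ((continuous_angularFourier S).comp continuous_fst).mul (by fun_prop)
  · refine Eventually.of_forall fun t z hz => ?_
    obtain ⟨x, -, rfl⟩ := hre z hz
    rw [norm_mul, show Complex.I * (t : ℂ) * x = Complex.I * ((t * x : ℝ) : ℂ) by push_cast; ring,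
      Complex.norm_exp_I_mul_ofReal, mul_one]
  · exact (by simpa using integrable_pow_mul_angularFourier S 0 :
      Integrable fun t => ‖angularFourier S t‖).2

theorem integrable_angularFourier (S : 𝓢(ℝ, ℂ)) : Integrable (angularFourier S) := by
  rw [← integrable_norm_iff (continuous_angularFourier S).aestronglyMeasurable]
  simpa using integrable_pow_mul_angularFourier S 0

/-- The translated density is the transform of S(x)e^{iux}. Shifting t by u and using the group law
factors out e^{iuh}. -/
theorem integral_angularFourier_sub_smul_expI {h : A} (hsa : IsSelfAdjoint h) {S : 𝓢(ℝ, ℂ)}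
    (h1 : ∀ x ∈ spectrum ℝ h, S x = 1) (u : ℝ) :
    ∫ t, angularFourier S (t - u) • expI h t = expI h u := by
  rw [← integral_add_right_eq_self (fun t => angularFourier S (t - u) • expI h t) u]
  simp only [add_sub_cancel_right, expI_add, ← smul_mul_assoc]
  have hint : Integrable fun t => angularFourier S t • expI h t := by
    refine (integrable_angularFourier S).norm.mono'
      ((continuous_angularFourier S).smul (continuous_const.expI continuous_id)).aestronglyMeasurable
      (Eventually.of_forall fun t => ?_)
    rw [norm_smul]
    exact mul_le_of_le_one_right (norm_nonneg _) (norm_expI_le_one hsa t)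
  rw [integral_mul_const_of_integrable hint, integral_angularFourier_smul_expI hsa h1, one_mul]

end FunctionalCalculus

/-! ### Fubini for ordered products and for product densities. -/

section ProductIntegrals

variable {A : Type*} [CStarAlgebra A]

/-- Fubini's theorem for an ordered product of functions in different variables, with values in a
noncommutative algebra. -/
theorem integrable_and_integral_list_prod {n : ℕ} (F : Fin n → ℝ → A)
    (hF : ∀ k, Integrable (F k)) :
    Integrable (fun x : Fin n → ℝ => (List.ofFn fun k => F k (x k)).prod) ∧
      ∫ x : Fin n → ℝ, (List.ofFn fun k => F k (x k)).prod =
        (List.ofFn fun k => ∫ t, F k t).prod := by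
  induction n with
  | zero => simp [volume_pi, measureReal_def]
  | succ n ih =>
    obtain ⟨ih1, ih2⟩ := ih (fun k => F k.succ) fun k => hF k.succ
    -- Peeling off the first variable respects the order of the noncommuting factors.
    have hmp := (volume_preserving_piFinSuccAbove (fun _ : Fin (n + 1) => ℝ) 0).symm
    have hfun : ∀ z : ℝ × (Fin n → ℝ), (List.ofFn fun k => F k
        ((MeasurableEquiv.piFinSuccAbove (fun _ : Fin (n + 1) => ℝ) 0).symm z k)).prod =
        ContinuousLinearMap.mul ℂ A (F 0 z.1) (List.ofFn fun k : Fin n => F k.succ (z.2 k)).prod := by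
      intro z
      simp [List.ofFn_succ, MeasurableEquiv.piFinSuccAbove_symm_apply, Fin.insertNthEquiv]
    have hint : Integrable (fun z : ℝ × (Fin n → ℝ) => ContinuousLinearMap.mul ℂ A (F 0 z.1)
        (List.ofFn fun k : Fin n => F k.succ (z.2 k)).prod) := by
      exact (hF 0).mul_prod ih1
    constructor
    · rw [← hmp.integrable_comp_emb (MeasurableEquiv.measurableEmbedding _)]
      simpa only [Function.comp_def, hfun] using hint
    · rw [← hmp.integral_comp']
      simp only [hfun]
      rw [Measure.volume_eq_prod, integral_prod_bilin _ (hF 0) ih1, ih2]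
      simp [List.ofFn_succ]

/-- Evaluation of an operator `A^{⊗ n} → A` at an elementary tensor. -/
noncomputable def Op.evalTprod {n : ℕ} (ρ : Fin n → A) : Op A n →L[ℂ] A :=
  LinearMap.mkContinuous
    { toFun := fun T => T.toCLM (PiTensorProduct.tprod ℂ ρ)
      map_add' := fun _ _ => rfl
      map_smul' := fun _ _ => rfl } ‖PiTensorProduct.tprod ℂ ρ‖ fun T => by
    rw [mul_comm]
    exact T.toCLM.le_opNorm _

theorem Op.evalTprod_apply {n : ℕ} (ρ : Fin n → A) (T : Op A n) :
    Op.evalTprod ρ T = T.toCLM (PiTensorProduct.tprod ℂ ρ) := rfl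

theorem Op.ext_evalTprod {n : ℕ} {S T : Op A n}
    (h : ∀ ρ, Op.evalTprod ρ S = Op.evalTprod ρ T) : S = T :=
  Op.ext_tprod h

theorem integrable_prod_smul_expOp {h : A} (hsa : IsSelfAdjoint h) (n : ℕ)
    {b : (Fin (n + 1) → ℝ) → ℂ} (hb : Integrable b) :
    Integrable fun ζ => b ζ • expOp h n ζ := by
  refine (hb.norm.mul_const ‖sandwich A n‖).mono'
    (hb.aestronglyMeasurable.smul (continuous_expOp h n).aestronglyMeasurable)
    (Eventually.of_forall fun ζ => ?_)
  rw [norm_smul]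
  exact mul_le_mul_of_nonneg_left (norm_expOp_le hsa n ζ) (norm_nonneg _)

/-- On an elementary tensor the integrand is an ordered product of functions of separate variables,
so the integral moves into each slot. -/
theorem integral_prod_smul_expOp {h : A} (hsa : IsSelfAdjoint h) (n : ℕ) {b : Fin (n + 1) → ℝ → ℂ}
    (hb : ∀ k, Integrable (b k)) :
    ∫ ζ : Fin (n + 1) → ℝ, (∏ k, b k (ζ k)) • expOp h n ζ =
      sandwich A n fun k => ∫ t, b k t • expI h t := by
  have hbI : ∀ k, Integrable fun t => b k t • expI h t := fun k =>
    (hb k).norm.mono' ((hb k).aestronglyMeasurable.smul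
      (continuous_const.expI continuous_id).aestronglyMeasurable)
      (Eventually.of_forall fun t => by
        rw [norm_smul]
        exact mul_le_of_le_one_right (norm_nonneg _) (norm_expI_le_one hsa t))
  refine Op.ext_evalTprod fun ρ => ?_
  rw [← ContinuousLinearMap.integral_comp_comm _
    (integrable_prod_smul_expOp hsa n (Integrable.fintype_prod_dep hb))]
  -- Padding ρ with a leading 1 makes v₀ρ₁v₁⋯ρₙvₙ a product of n + 1 factors of the same shape.
  have hprod : ∀ v : Fin (n + 1) → A, Op.evalTprod ρ (sandwich A n v) =
      (List.ofFn fun k => Fin.cons (α := fun _ => A) 1 ρ k * v k).prod := fun v => by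
    rw [Op.evalTprod_apply, sandwich_tprod]
    simp [List.ofFn_succ]
  have h1 : ∀ ζ : Fin (n + 1) → ℝ, Op.evalTprod ρ ((∏ k, b k (ζ k)) • expOp h n ζ) =
      (List.ofFn fun k => Fin.cons (α := fun _ => A) 1 ρ k * (b k (ζ k) • expI h (ζ k))).prod :=
    fun ζ => by
      rw [expOp_eq_sandwich, ← ContinuousMultilinearMap.map_smul_univ, hprod]
  simp only [h1]
  rw [(integrable_and_integral_list_prod
    (fun k t => Fin.cons (α := fun _ => A) 1 ρ k * (b k t • expI h t))
    fun k => (hbI k).const_mul _).2, hprod]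
  congr 2
  funext k
  exact integral_const_mul_of_integrable (hbI k)

end ProductIntegrals

/-! ### Product cutoffs. -/

section Cutoff

/-- The function `(x₀, …, xₙ) ↦ φ x₀ ⋯ φ xₙ`. -/
def tensorPower (n : ℕ) (φ : ℝ → ℂ) (x : Fin (n + 1) → ℝ) : ℂ := ∏ k, φ (x k)

variable {φ : ℝ → ℂ}

theorem contDiff_tensorPower (n : ℕ) (hφ : ContDiff ℝ ∞ φ) : ContDiff ℝ ∞ (tensorPower n φ) :=
  contDiff_prod fun k _ => hφ.comp (contDiff_apply ℝ ℝ k)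

theorem tensorPower_eq_zero {n : ℕ} {x : Fin (n + 1) → ℝ}
    (hx : x ∉ Set.univ.pi fun _ => tsupport φ) : tensorPower n φ x = 0 := by
  simp only [Set.mem_univ_pi, not_forall] at hx
  obtain ⟨k, hk⟩ := hx
  exact Finset.prod_eq_zero (Finset.mem_univ k) (image_eq_zero_of_notMem_tsupport hk)

theorem hasCompactSupport_tensorPower (n : ℕ) (hc : HasCompactSupport φ) :
    HasCompactSupport (tensorPower n φ) :=
  HasCompactSupport.intro (isCompact_univ_pi fun _ => hc) fun _ hx => tensorPower_eq_zero hx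

theorem fourierCoeff_tensorPower (n : ℕ) (hφ : ContDiff ℝ ∞ φ) (hc : HasCompactSupport φ)
    (ξ : Fin (n + 1) → ℝ) :
    fourierCoeff n (tensorPower n φ) ξ = ∏ k, angularFourier (hc.toSchwartzMap hφ) (ξ k) := by
  have h1 : ∀ x : Fin (n + 1) → ℝ,
      tensorPower n φ x * Complex.exp (-(Complex.I * ((∑ k, x k * ξ k : ℝ) : ℂ))) =
        ∏ k, φ (x k) * Complex.exp (-(Complex.I * ((x k * ξ k : ℝ) : ℂ))) := fun x => by
    rw [Finset.prod_mul_distrib, ← Complex.exp_sum, tensorPower]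
    push_cast
    rw [Finset.mul_sum, Finset.sum_neg_distrib]
  simp only [angularFourier_eq_integral, fourierCoeff, h1]
  rw [Finset.prod_mul_distrib, integral_fintype_prod_volume_eq_prod
    (fun k t => φ t * Complex.exp (-(Complex.I * ((t * ξ k : ℝ) : ℂ))))]
  congr 1
  · simp [← inv_pow, mul_comm]
  · simp [mul_comm]

end Cutoff

/-! ### The calculus of cut-off superpositions of exponentials. -/

section Superposition

variable {A : Type*} [CStarAlgebra A] {m : ℕ} {φ : ℝ → ℂ}
  {Ω : Type*} [MeasurableSpace Ω] {ν : Measure Ω} [SFinite ν] {c : Ω → ℂ}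
  {η : Ω → Fin (m + 1) → ℝ}

theorem norm_exp_neg_I_mul_ofReal (x : ℝ) : ‖Complex.exp (-(Complex.I * (x : ℂ)))‖ = 1 := by
  rw [← mul_neg, ← Complex.ofReal_neg, Complex.norm_exp_I_mul_ofReal]

/-- The Fourier transform of the product of `g` with a superposition of exponentials. -/
theorem fourierCoeff_mul_superposition {g : (Fin (m + 1) → ℝ) → ℂ} (hg : Integrable g)
    (hci : Integrable c ν) (hη : Measurable η) (ζ : Fin (m + 1) → ℝ) :
    fourierCoeff m (fun x => g x *
        ∫ w, c w * Complex.exp (Complex.I * ((∑ k, x k * η w k : ℝ) : ℂ)) ∂ν) ζ =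
      ∫ w, c w * fourierCoeff m g (ζ - η w) ∂ν := by
  have hηk : ∀ k, Measurable fun w => η w k := fun k => (measurable_pi_apply k).comp hη
  have hint : Integrable (fun p : (Fin (m + 1) → ℝ) × Ω => g p.1 * c p.2 *
      Complex.exp (-(Complex.I * ((∑ k, p.1 k * (ζ - η p.2) k : ℝ) : ℂ)))) (volume.prod ν) := by
    refine (hg.mul_prod hci).norm.mono' ((hg.mul_prod hci).aestronglyMeasurable.mul
      (Measurable.aestronglyMeasurable ?_)) (Eventually.of_forall fun p => ?_)
    · simp only [Pi.sub_apply]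
      fun_prop
    · rw [norm_mul, norm_exp_neg_I_mul_ofReal, mul_one]
  have h1 : ∀ (x : Fin (m + 1) → ℝ) (w : Ω),
      Complex.exp (-(Complex.I * ((∑ k, x k * (ζ - η w) k : ℝ) : ℂ))) =
        Complex.exp (Complex.I * ((∑ k, x k * η w k : ℝ) : ℂ)) *
          Complex.exp (-(Complex.I * ((∑ k, x k * ζ k : ℝ) : ℂ))) := fun x w => by
    rw [← Complex.exp_add]
    congr 1
    simp only [Pi.sub_apply, mul_sub, Finset.sum_sub_distrib]
    push_cast
    ring
  have h2 : ∀ w, c w * fourierCoeff m g (ζ - η w) =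
      (((2 * Real.pi) ^ (m + 1) : ℝ) : ℂ)⁻¹ * ∫ x : Fin (m + 1) → ℝ, g x * c w *
        Complex.exp (-(Complex.I * ((∑ k, x k * (ζ - η w) k : ℝ) : ℂ))) := fun w => by
    rw [fourierCoeff, mul_left_comm, ← integral_const_mul]
    congr 2
    funext x
    ring
  simp only [h2]
  rw [integral_const_mul, ← integral_integral_swap hint, fourierCoeff]
  congr 2
  funext x
  rw [← integral_const_mul, ← integral_mul_const]
  congr 1
  funext w
  rw [h1]
  ring

/-- The L¹ norm of a translate of b does not depend on w. This joint integrability licenses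
exchanging the frequency integral with the superposition. -/
theorem integrable_mul_comp_sub {b : (Fin (m + 1) → ℝ) → ℂ} (hb : Integrable b)
    (hbc : Continuous b) (hci : Integrable c ν) (hη : Measurable η) :
    Integrable (fun p : (Fin (m + 1) → ℝ) × Ω => c p.2 * b (p.1 - η p.2)) (volume.prod ν) := by
  have hm : AEStronglyMeasurable (fun p : (Fin (m + 1) → ℝ) × Ω => c p.2 * b (p.1 - η p.2))
      (volume.prod ν) :=
    hci.aestronglyMeasurable.comp_snd.mul
      (hbc.measurable.comp (measurable_fst.sub (hη.comp measurable_snd))).aestronglyMeasurable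
  refine (integrable_prod_iff' hm).2 ⟨Eventually.of_forall fun w => ?_, ?_⟩
  · exact (hb.comp_sub_right (η w)).const_mul (c w)
  · simp only [norm_mul, integral_const_mul]
    have h1 : ∀ w, ∫ ζ : Fin (m + 1) → ℝ, ‖b (ζ - η w)‖ = ∫ ζ, ‖b ζ‖ := fun w =>
      integral_sub_right_eq_self (fun ζ => ‖b ζ‖) (η w)
    simp only [h1]
    exact hci.norm.mul_const _

/-- The case of a single exponential: cutting off e^{ix·ξ} translates the transform of the cutoff,
and the product structure reduces the claim to one variable in each slot. -/
theorem integral_fourierCoeff_sub_smul_expOp {h : A} (hsa : IsSelfAdjoint h)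
    (hφ : ContDiff ℝ ∞ φ) (hc : HasCompactSupport φ) (h1 : ∀ x ∈ spectrum ℝ h, φ x = 1)
    (ξ : Fin (m + 1) → ℝ) :
    ∫ ζ, fourierCoeff m (tensorPower m φ) (ζ - ξ) • expOp h m ζ = expOp h m ξ := by
  simp only [fourierCoeff_tensorPower m hφ hc, Pi.sub_apply]
  rw [integral_prod_smul_expOp hsa m
    (b := fun k t => angularFourier (hc.toSchwartzMap hφ) (t - ξ k))
    fun k => (integrable_angularFourier _).comp_sub_right _, expOp_eq_sandwich]
  congr 1
  funext k
  exact integral_angularFourier_sub_smul_expI hsa h1 (ξ k)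

/-- The Schwartz functional calculus of a superposition of exponentials, cut off away from the
spectrum, is the superposition of the exponential operators. -/
theorem schwartzIntegral_tensorPower_mul_superposition {h : A} (hsa : IsSelfAdjoint h)
    (hφ : ContDiff ℝ ∞ φ) (hc : HasCompactSupport φ) (h1 : ∀ x ∈ spectrum ℝ h, φ x = 1)
    (hci : Integrable c ν) (hη : Measurable η) :
    schwartzIntegral h m (fun x => tensorPower m φ x *
        ∫ w, c w * Complex.exp (Complex.I * ((∑ k, x k * η w k : ℝ) : ℂ)) ∂ν) =
      ∫ w, c w • expOp h m (η w) ∂ν := by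
  have hT := contDiff_tensorPower m hφ
  have hTc := hasCompactSupport_tensorPower m hc
  have hb := integrable_fourierCoeff hT hTc
  have hscal := integrable_mul_comp_sub hb (continuous_fourierCoeff hT hTc) hci hη
  have hint : Integrable (fun p : (Fin (m + 1) → ℝ) × Ω =>
      (c p.2 * fourierCoeff m (tensorPower m φ) (p.1 - η p.2)) • expOp h m p.1)
      (volume.prod ν) := by
    refine (hscal.norm.mul_const ‖sandwich A m‖).mono' (hscal.aestronglyMeasurable.smul
      (continuous_expOp h m).aestronglyMeasurable.comp_fst) (Eventually.of_forall fun p => ?_)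
    rw [norm_smul]
    exact mul_le_mul_of_nonneg_left (norm_expOp_le hsa m _) (norm_nonneg _)
  rw [schwartzIntegral]
  simp only [fourierCoeff_mul_superposition (hT.continuous.integrable_of_hasCompactSupport hTc)
    hci hη, ← integral_smul_const]
  rw [integral_integral_swap hint]
  congr 1
  funext w
  simp only [mul_smul]
  rw [integral_smul, integral_fourierCoeff_sub_smul_expOp hsa hφ hc h1]

/-- The Schwartz functional calculus does not see modifications away from the spectrum. -/
theorem schwartzIntegral_tensorPower_mul {h : A} (hsa : IsSelfAdjoint h)
    (hφ : ContDiff ℝ ∞ φ) (hc : HasCompactSupport φ) (h1 : ∀ x ∈ spectrum ℝ h, φ x = 1)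
    {g : (Fin (m + 1) → ℝ) → ℂ} (hg : ContDiff ℝ ∞ g) (hgc : HasCompactSupport g) :
    schwartzIntegral h m (fun x => tensorPower m φ x * g x) = schwartzIntegral h m g := by
  -- Fourier inversion presents `g` as a superposition with density its own transform and η the
  -- identity.
  have h2 := schwartzIntegral_tensorPower_mul_superposition (ν := volume) hsa hφ hc h1
    (integrable_fourierCoeff hg hgc) measurable_id
  simp only [id, integral_fourierCoeff_mul_exp hg hgc] at h2
  exact h2

end Superposition

/-! ### Existence of localizations and independence of the choice. -/

section Localization

variable {A : Type*} [CStarAlgebra A] {n : ℕ}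

/-- The calculus only needs φ = 1 on K; the open V is there because a localization must agree with
`f` near the cube of the spectrum. -/
theorem exists_cutoff {K U : Set ℝ} (hK : IsCompact K) (hU : IsOpen U) (hKU : K ⊆ U) :
    ∃ φ : ℝ → ℂ, ContDiff ℝ ∞ φ ∧ HasCompactSupport φ ∧ tsupport φ ⊆ U ∧
      ∃ V, IsOpen V ∧ K ⊆ V ∧ ∀ x ∈ V, φ x = 1 := by
  obtain ⟨L, hL, hKL, hLU⟩ := exists_compact_between hK hU hKU
  obtain ⟨f, hf1, hf0, -⟩ := exists_contMDiffMap_one_nhds_of_subset_interior (n := ⊤)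
    (modelWithCornersSelf ℝ ℝ) hK.isClosed hKL
  obtain ⟨V, hV, hKV, hV1⟩ := eventually_nhdsSet_iff_exists.1 hf1
  have hsupp : ∀ x ∉ L, ((f x : ℝ) : ℂ) = 0 := fun x hx => by rw [hf0 x hx, Complex.ofReal_zero]
  refine ⟨fun x => (f x : ℂ), Complex.ofRealCLM.contDiff.comp f.contMDiff.contDiff,
    HasCompactSupport.intro hL hsupp, ?_, V, hV, hKV, fun x hx => by simp [hV1 x hx]⟩
  refine (closure_minimal (fun x hx => ?_) hL.isClosed).trans hLU
  by_contra hxL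
  exact hx (hsupp x hxL)

theorem isCompact_spectrum_real (h : A) : IsCompact (spectrum ℝ h) := spectrum.isCompact h

theorem isOpen_cube {U : Set ℝ} (hU : IsOpen U) (n : ℕ) :
    IsOpen (Set.univ.pi fun _ : Fin (n + 1) => U) :=
  isOpen_set_pi Set.finite_univ fun _ _ => hU

/-- Neighbourhoods of the cube of the spectrum contain cubes of neighbourhoods. -/
theorem exists_cube_subset {K : Set ℝ} (hK : IsCompact K) {W : Set (Fin (n + 1) → ℝ)}
    (hW : IsOpen W) (hKW : (Set.univ.pi fun _ => K) ⊆ W) :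
    ∃ U, IsOpen U ∧ K ⊆ U ∧ (Set.univ.pi fun _ : Fin (n + 1) => U) ⊆ W := by
  obtain ⟨δ, hδ, hsub⟩ :=
    (isCompact_univ_pi fun _ : Fin (n + 1) => hK).exists_thickening_subset_open hW hKW
  refine ⟨Metric.thickening δ K, Metric.isOpen_thickening, Metric.self_subset_thickening hδ K,
    fun x hx => hsub ?_⟩
  simp only [Set.mem_univ_pi, Metric.mem_thickening_iff] at hx
  choose y hy hxy using hx
  exact Metric.mem_thickening_iff.2 ⟨y, fun k _ => hy k, (dist_pi_lt_iff hδ).2 hxy⟩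

/-- Off the closed cube of supports the product vanishes locally, so the values of `f` outside the
cube of U play no role. -/
theorem contDiff_tensorPower_mul {φ : ℝ → ℂ} {U : Set ℝ} (hU : IsOpen U) (hφ : ContDiff ℝ ∞ φ)
    (hφU : tsupport φ ⊆ U) {f : (Fin (n + 1) → ℝ) → ℂ}
    (hf : ContDiffOn ℝ ∞ f (Set.univ.pi fun _ : Fin (n + 1) => U)) :
    ContDiff ℝ ∞ fun x => tensorPower n φ x * f x := by
  rw [contDiff_iff_contDiffAt]
  intro x
  by_cases hx : x ∈ Set.univ.pi fun _ : Fin (n + 1) => tsupport φ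
  · have hxU : x ∈ Set.univ.pi fun _ : Fin (n + 1) => U := Set.pi_mono (fun _ _ => hφU) hx
    exact (contDiff_tensorPower n hφ).contDiffAt.mul
      (hf.contDiffAt ((isOpen_cube hU n).mem_nhds hxU))
  · have hcl : IsClosed (Set.univ.pi fun _ : Fin (n + 1) => tsupport φ) :=
      isClosed_set_pi fun _ _ => isClosed_tsupport φ
    refine (contDiffAt_const (c := (0 : ℂ))).congr_of_eventuallyEq ?_
    filter_upwards [hcl.isOpen_compl.mem_nhds hx] with y hy
    rw [tensorPower_eq_zero hy, zero_mul]

/-- Keeping `g` apart from `f` lets the cutoff be applied both to `f` itself and to the face of a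
localization, which equals the face of `f` only near the spectrum. -/
theorem isLocalization_tensorPower_mul {h : A} {φ : ℝ → ℂ} {U V : Set ℝ} (hU : IsOpen U)
    (hφ : ContDiff ℝ ∞ φ) (hc : HasCompactSupport φ) (hφU : tsupport φ ⊆ U)
    {f g : (Fin (n + 1) → ℝ) → ℂ}
    (hg : ContDiffOn ℝ ∞ g (Set.univ.pi fun _ : Fin (n + 1) => U)) (hV : IsOpen V)
    (hKV : spectrum ℝ h ⊆ V) (hφV : ∀ x ∈ V, φ x = 1)
    (hfg : ∀ x ∈ Set.univ.pi fun _ : Fin (n + 1) => V, g x = f x) :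
    IsLocalization h n f fun x => tensorPower n φ x * g x where
  contDiff := contDiff_tensorPower_mul hU hφ hφU hg
  hasCompactSupport := (hasCompactSupport_tensorPower n hc).mul_right
  eventuallyEq := by
    refine eventually_nhdsSet_iff_exists.2
      ⟨_, isOpen_cube hV n, Set.pi_mono fun _ _ => hKV, fun x hx => ?_⟩
    beta_reduce
    rw [tensorPower, Finset.prod_eq_one fun k _ => hφV _ (hx k (Set.mem_univ k)), one_mul,
      hfg x hx]

theorem exists_isLocalization {h : A} {f : (Fin (n + 1) → ℝ) → ℂ} (hf : f ∈ CSpec h n) :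
    ∃ g, IsLocalization h n f g := by
  obtain ⟨U, hU, hKU, hfU⟩ := hf
  obtain ⟨φ, hφ, hc, hφU, V, hV, hKV, hφV⟩ := exists_cutoff (isCompact_spectrum_real h) hU hKU
  exact ⟨_, isLocalization_tensorPower_mul hU hφ hc hφU hfU hV hKV hφV fun _ _ => rfl⟩

/-- With a cutoff supported where g₁ = g₂, the products φ⊗⋯⊗φ·gᵢ coincide, and multiplying by the
cutoff does not change either calculus. -/
theorem schwartzIntegral_eq_of_isLocalization {h : A} (hsa : IsSelfAdjoint h)
    {f g₁ g₂ : (Fin (n + 1) → ℝ) → ℂ} (h₁ : IsLocalization h n f g₁)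
    (h₂ : IsLocalization h n f g₂) : schwartzIntegral h n g₁ = schwartzIntegral h n g₂ := by
  obtain ⟨W, hW, hKW, hWe⟩ := eventually_nhdsSet_iff_exists.1
    (h₁.eventuallyEq.trans h₂.eventuallyEq.symm)
  obtain ⟨U, hU, hKU, hUW⟩ := exists_cube_subset (isCompact_spectrum_real h) hW hKW
  obtain ⟨φ, hφ, hc, hφU, V, -, hKV, hφV⟩ := exists_cutoff (isCompact_spectrum_real h) hU hKU
  have hφ1 : ∀ x ∈ spectrum ℝ h, φ x = 1 := fun x hx => hφV x (hKV hx)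
  rw [← schwartzIntegral_tensorPower_mul hsa hφ hc hφ1 h₁.contDiff h₁.hasCompactSupport,
    ← schwartzIntegral_tensorPower_mul hsa hφ hc hφ1 h₂.contDiff h₂.hasCompactSupport]
  congr 1
  funext x
  by_cases hx : x ∈ Set.univ.pi fun _ : Fin (n + 1) => tsupport φ
  · rw [hWe x (hUW (Set.pi_mono (fun _ _ => hφU) hx))]
  · rw [tensorPower_eq_zero hx, zero_mul, zero_mul]

theorem rearr_eq_schwartzIntegral {h : A} (hsa : IsSelfAdjoint h)
    {f g : (Fin (n + 1) → ℝ) → ℂ} (hg : IsLocalization h n f g) :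
    rearr h n f = schwartzIntegral h n g := by
  have hex : ∃ g, IsLocalization h n f g := ⟨g, hg⟩
  rw [rearr, dif_pos hex]
  exact schwartzIntegral_eq_of_isLocalization hsa hex.choose_spec hg

end Localization

/-! ### Divided differences as averages, and smooth parameter integrals. -/

section DividedDifference

/-- A divided difference is the average of the derivative over the segment. -/
theorem dslope_eq_intervalIntegral {G G' : ℝ → ℂ} (hG : ∀ z, HasDerivAt G (G' z) z)
    (hG' : Continuous G') (p q : ℝ) :
    dslope G p q = ∫ s in (0 : ℝ)..1, G' (s * p + (1 - s) * q) := by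
  rcases eq_or_ne q p with rfl | hqp
  · rw [dslope_same, (hG q).deriv]
    have : ∀ s : ℝ, s * q + (1 - s) * q = q := fun s => by ring
    simp [this]
  · rw [dslope_of_ne _ hqp, slope_def_module]
    have hd : ∀ s : ℝ, HasDerivAt (fun s : ℝ => G (s * p + (1 - s) * q))
        ((p - q) • G' (s * p + (1 - s) * q)) s := fun s => by
      refine (hG (s * p + (1 - s) * q)).scomp s ?_
      refine (((hasDerivAt_id s).mul_const p).add
        (((hasDerivAt_id s).const_sub 1).mul_const q)).congr_deriv ?_
      ring
    have hint := intervalIntegral.integral_eq_sub_of_hasDerivAt (a := 0) (b := 1)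
      (fun s _ => hd s)
      (((hG'.comp (by fun_prop)).const_smul (p - q)).intervalIntegrable _ _)
    rw [intervalIntegral.integral_smul] at hint
    simp only [one_mul, sub_self, zero_mul, add_zero, sub_zero, zero_add] at hint
    rw [← neg_sub (G p), ← hint, ← neg_sub p q, inv_neg, neg_smul_neg,
      inv_smul_smul₀ (sub_ne_zero.2 hqp.symm)]

/-- The integral is the convolution, evaluated at 0, of the indicator of (0, 1] with s ↦ H(p, -s),
and smoothness in parameters is known for convolutions with compactly supported kernels. -/
theorem contDiff_intervalIntegral_param {P : Type*} [NormedAddCommGroup P] [NormedSpace ℝ P]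
    {H : P × ℝ → ℂ} (hH : ContDiff ℝ ∞ H) :
    ContDiff ℝ ∞ fun p => ∫ s in (0 : ℝ)..1, H (p, s) := by
  -- The cutoff supplies the compact support; at the point 0 the kernel is evaluated at -s with s in
  -- (0, 1], so χ must be 1 on [-1, 0].
  obtain ⟨χ, hχ, hχc, -, V, -, hKV, hχV⟩ :=
    exists_cutoff (K := Set.Icc (-1) 0) (U := Set.univ) isCompact_Icc isOpen_univ
      (Set.subset_univ _)
  have h1 := contDiffOn_convolution_right_with_param_comp (μ := volume) (n := ⊤)
    (ContinuousLinearMap.mul ℝ ℂ) (s := (Set.univ : Set P)) (v := fun _ => (0 : ℝ))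
    (f := Set.indicator (Set.Ioc (0 : ℝ) 1) fun _ => (1 : ℂ))
    (g := fun p u => χ u * H (p, -u)) (k := tsupport χ) contDiffOn_const isOpen_univ hχc
    (fun p u _ hu => by rw [image_eq_zero_of_notMem_tsupport hu, zero_mul])
    ((integrable_indicator_iff measurableSet_Ioc).2
      (integrableOn_const (by simp))).locallyIntegrable
    ((hχ.comp contDiff_snd).mul (hH.comp (contDiff_fst.prodMk contDiff_snd.neg))).contDiffOn
  rw [← contDiffOn_univ]
  refine h1.congr fun p _ => ?_
  rw [convolution_def, intervalIntegral.integral_of_le zero_le_one,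
    ← integral_indicator measurableSet_Ioc]
  congr 1
  funext s
  by_cases hs : s ∈ Set.Ioc (0 : ℝ) 1
  · have : χ (0 - s) = 1 := hχV _ (hKV ⟨by linarith [hs.2], by linarith [hs.1]⟩)
    rw [zero_sub] at this
    simp [hs, this]
  · simp [hs]

end DividedDifference

/-! ### Locality and smoothness of the face maps. -/

section Face

variable {n : ℕ}

/-- Omitting slot j or slot j + 1 leaves the same enumeration except at j. `face` omits j + 1, while
`splitFreq` inserts at j. -/
theorem castSucc_succAbove_of_ne {j k : Fin (n + 1)} (hk : k ≠ j) :
    j.castSucc.succAbove k = j.succ.succAbove k := by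
  rcases lt_or_gt_of_ne hk with h | h
  · rw [Fin.succAbove_of_castSucc_lt _ _ (by simpa using h),
      Fin.succAbove_of_castSucc_lt _ _ (Fin.castSucc_lt_succ_iff.2 h.le)]
  · rw [Fin.succAbove_of_le_castSucc _ _ (by simpa using h.le),
      Fin.succAbove_of_le_castSucc _ _ (by
        simp only [Fin.le_def, Fin.val_succ, Fin.val_castSucc]; exact h)]

theorem update_mem_cube {U : Set ℝ} {x : Fin (n + 2) → ℝ} (hx : ∀ k, x k ∈ U)
    (j : Fin (n + 1)) {z : ℝ} (hz : z ∈ U) :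
    Function.update (fun k => x (j.succ.succAbove k)) j z ∈
      Set.univ.pi fun _ : Fin (n + 1) => U := by
  intro k _
  rcases eq_or_ne k j with rfl | hk
  · simpa using hz
  · simpa [hk] using hx _

/-- The face map is local. -/
theorem face_congr {U : Set ℝ} (hU : IsOpen U) {f g : (Fin (n + 1) → ℝ) → ℂ}
    (hfg : ∀ x ∈ Set.univ.pi fun _ : Fin (n + 1) => U, g x = f x) (j : Fin (n + 1))
    {x : Fin (n + 2) → ℝ} (hx : x ∈ Set.univ.pi fun _ : Fin (n + 2) => U) :
    face n j g x = face n j f x := by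
  have hx' : ∀ k, x k ∈ U := fun k => hx k (Set.mem_univ k)
  have heq : ∀ z ∈ U, g (Function.update (fun k => x (j.succ.succAbove k)) j z) =
      f (Function.update (fun k => x (j.succ.succAbove k)) j z) := fun z hz =>
    hfg _ (update_mem_cube hx' j hz)
  rw [face, face]
  rcases eq_or_ne (x j.succ) (x j.castSucc) with h | h
  · rw [h, dslope_same, dslope_same]
    -- On the diagonal a derivative is compared, so equality is needed on a neighbourhood; this is
    -- where openness of U enters.
    refine EventuallyEq.deriv_eq ?_
    filter_upwards [hU.mem_nhds (hx' j.castSucc)] with z hz using heq z hz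
  · rw [dslope_of_ne _ h, dslope_of_ne _ h, slope_def_module, slope_def_module,
      heq _ (hx' _), heq _ (hx' _)]

theorem hasDerivAt_comp_update {g : (Fin (n + 1) → ℝ) → ℂ} (hg : ContDiff ℝ ∞ g)
    (y : Fin (n + 1) → ℝ) (j : Fin (n + 1)) (z : ℝ) :
    HasDerivAt (fun z => g (Function.update y j z))
      (fderiv ℝ g (Function.update y j z) (Pi.single j 1)) z :=
  ((hg.differentiable (by simp)) _).hasFDerivAt.comp_hasDerivAt z (hasDerivAt_update y j z)

/-- Writing the divided difference as an average of ∂ⱼg over a segment removes the apparent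
singularity on the diagonal. -/
theorem contDiff_face {g : (Fin (n + 1) → ℝ) → ℂ} (hg : ContDiff ℝ ∞ g) (j : Fin (n + 1)) :
    ContDiff ℝ ∞ (face n j g) := by
  have hupd : ContDiff ℝ ∞ fun p : (Fin (n + 2) → ℝ) × ℝ =>
      Function.update (fun k => p.1 (j.succ.succAbove k)) j
        (p.2 * p.1 j.castSucc + (1 - p.2) * p.1 j.succ) := by
    rw [contDiff_pi]
    intro k
    rcases eq_or_ne k j with rfl | hk
    · simp only [Function.update_self]
      fun_prop
    · simp only [Function.update_of_ne hk]
      fun_prop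
  have hH : ContDiff ℝ ∞ fun p : (Fin (n + 2) → ℝ) × ℝ =>
      fderiv ℝ g (Function.update (fun k => p.1 (j.succ.succAbove k)) j
        (p.2 * p.1 j.castSucc + (1 - p.2) * p.1 j.succ)) (Pi.single j 1) :=
    ((hg.fderiv_right (m := ∞) (by simp)).comp hupd).clm_apply contDiff_const
  convert contDiff_intervalIntegral_param hH using 1
  funext x
  refine dslope_eq_intervalIntegral (fun z => hasDerivAt_comp_update hg _ j z) ?_ _ _
  exact ((hg.continuous_fderiv (by simp)).comp
    (continuous_const.update j continuous_id)).clm_apply continuous_const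

/-- U need not be an interval, so the segment between two arguments may leave it. Smoothness being
local, `f` is first replaced by a globally smooth function that agrees with it when all arguments
are near coordinates of x. -/
theorem contDiffOn_face {U : Set ℝ} (hU : IsOpen U) {f : (Fin (n + 1) → ℝ) → ℂ}
    (hf : ContDiffOn ℝ ∞ f (Set.univ.pi fun _ : Fin (n + 1) => U)) (j : Fin (n + 1)) :
    ContDiffOn ℝ ∞ (face n j f) (Set.univ.pi fun _ : Fin (n + 2) => U) := by
  intro x hx
  obtain ⟨φ, hφ, hc, hφU, V, hV, hKV, hφV⟩ :=
    exists_cutoff (Set.finite_range x).isCompact hU (Set.range_subset_iff.2 fun k =>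
      hx k (Set.mem_univ k))
  refine ContDiffAt.contDiffWithinAt ?_
  refine (contDiff_face (contDiff_tensorPower_mul hU hφ hφU hf) j).contDiffAt.congr_of_eventuallyEq
    ?_
  have hxV : x ∈ Set.univ.pi fun _ : Fin (n + 2) => V := fun k _ => hKV (Set.mem_range_self k)
  filter_upwards [(isOpen_cube hV (n + 1)).mem_nhds hxV] with y hy
  refine (face_congr hV (fun z hz => ?_) j hy).symm
  rw [tensorPower, Finset.prod_eq_one fun k _ => hφV _ (hz k (Set.mem_univ k)), one_mul]

theorem face_mem_CSpec {A : Type*} [CStarAlgebra A] {h : A} {f : (Fin (n + 1) → ℝ) → ℂ}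
    (hf : f ∈ CSpec h n) (j : Fin (n + 1)) : face n j f ∈ CSpec h (n + 1) := by
  obtain ⟨U, hU, hKU, hfU⟩ := hf
  exact ⟨U, hU, hKU, contDiffOn_face hU hfU j⟩

end Face

/-! ### Faces as superpositions of exponentials with split frequencies. -/

section FaceSuperposition

variable {n : ℕ}

/-- The frequencies `(ξ₀, …, ξⱼ₋₁, s ξⱼ, (1 - s) ξⱼ, ξⱼ₊₁, …, ξₙ)`. -/
def splitFreq (j : Fin (n + 1)) (p : (Fin (n + 1) → ℝ) × ℝ) : Fin (n + 2) → ℝ :=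
  j.castSucc.insertNth (α := fun _ => ℝ) (p.2 * p.1 j)
    (Function.update p.1 j ((1 - p.2) * p.1 j))

theorem continuous_splitFreq (j : Fin (n + 1)) : Continuous (splitFreq (n := n) j) := by
  unfold splitFreq
  exact Continuous.finInsertNth j.castSucc (by fun_prop) (continuous_fst.update j (by fun_prop))

/-- Averaging two arguments against one frequency is the same as splitting that frequency between
the two arguments. -/
theorem sum_update_mul_eq_sum_mul_splitFreq (j : Fin (n + 1)) (x : Fin (n + 2) → ℝ)
    (ξ : Fin (n + 1) → ℝ) (s : ℝ) :
    ∑ k, Function.update (fun k => x (j.succ.succAbove k)) j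
        (s * x j.castSucc + (1 - s) * x j.succ) k * ξ k =
      ∑ k, x k * splitFreq j (ξ, s) k := by
  rw [Fin.sum_univ_succAbove _ j.castSucc, ← Finset.add_sum_erase _ _ (Finset.mem_univ j),
    ← Finset.add_sum_erase (a := j) Finset.univ (fun k => x (j.castSucc.succAbove k) *
      splitFreq j (ξ, s) (j.castSucc.succAbove k)) (Finset.mem_univ j)]
  have hrest : ∀ k ∈ Finset.univ.erase j,
      Function.update (fun k => x (j.succ.succAbove k)) j
        (s * x j.castSucc + (1 - s) * x j.succ) k * ξ k =
      x (j.castSucc.succAbove k) * splitFreq j (ξ, s) (j.castSucc.succAbove k) := by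
    intro k hk
    have hk' := Finset.ne_of_mem_erase hk
    rw [splitFreq, Fin.insertNth_apply_succAbove, Function.update_of_ne hk',
      Function.update_of_ne hk', castSucc_succAbove_of_ne hk']
  rw [Finset.sum_congr rfl hrest]
  simp [splitFreq]
  ring

theorem integrable_fourierCoeff_mul_coord {g : (Fin (n + 1) → ℝ) → ℂ} (hg : ContDiff ℝ ∞ g)
    (hc : HasCompactSupport g) (j : Fin (n + 1)) :
    Integrable fun ξ : Fin (n + 1) → ℝ => fourierCoeff n g ξ * (Complex.I * (ξ j : ℂ)) := by
  refine (integrable_norm_mul_fourierCoeff hg hc).mono' (Continuous.aestronglyMeasurable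
    ((continuous_fourierCoeff hg hc).mul (by fun_prop))) (Eventually.of_forall fun ξ => ?_)
  rw [norm_mul, norm_mul, Complex.norm_I, one_mul, Complex.norm_real, mul_comm]
  exact mul_le_mul_of_nonneg_right (norm_le_pi_norm ξ j) (norm_nonneg _)

theorem integrable_fourierCoeff_mul_coord_prod {g : (Fin (n + 1) → ℝ) → ℂ} (hg : ContDiff ℝ ∞ g)
    (hc : HasCompactSupport g) (j : Fin (n + 1)) :
    Integrable (fun p : (Fin (n + 1) → ℝ) × ℝ => fourierCoeff n g p.1 * (Complex.I * (p.1 j : ℂ)))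
      (volume.prod (volume.restrict (Set.Ioc (0 : ℝ) 1))) :=
  (integrable_fourierCoeff_mul_coord hg hc j).comp_fst _

/-- Differentiation under the integral in the inversion formula, dominated by the first moment of
the transform. -/
theorem fderiv_eq_integral_fourierCoeff {g : (Fin (n + 1) → ℝ) → ℂ} (hg : ContDiff ℝ ∞ g)
    (hc : HasCompactSupport g) (j : Fin (n + 1)) (y : Fin (n + 1) → ℝ) (z : ℝ) :
    fderiv ℝ g (Function.update y j z) (Pi.single j 1) =
      ∫ ξ : Fin (n + 1) → ℝ, fourierCoeff n g ξ * (Complex.I * (ξ j : ℂ)) *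
        Complex.exp (Complex.I * ((∑ k, Function.update y j z k * ξ k : ℝ) : ℂ)) := by
  have hcont := continuous_fourierCoeff hg hc
  have hderiv : ∀ (ξ : Fin (n + 1) → ℝ) (z : ℝ), HasDerivAt
      (fun z => fourierCoeff n g ξ *
        Complex.exp (Complex.I * ((∑ k, Function.update y j z k * ξ k : ℝ) : ℂ)))
      (fourierCoeff n g ξ * (Complex.I * (ξ j : ℂ)) *
        Complex.exp (Complex.I * ((∑ k, Function.update y j z k * ξ k : ℝ) : ℂ))) z := by
    intro ξ z
    have h1 : HasDerivAt (fun z => ∑ k, Function.update y j z k * ξ k) (ξ j) z := by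
      refine (HasDerivAt.fun_sum (u := Finset.univ) fun k _ =>
        (hasDerivAt_pi.1 (hasDerivAt_update y j z) k).mul_const (ξ k)).congr_deriv ?_
      simp [Pi.single_apply]
    refine ((h1.ofReal_comp.const_mul Complex.I).cexp.const_mul (fourierCoeff n g ξ)).congr_deriv ?_
    ring
  have hmain := (hasDerivAt_integral_of_dominated_loc_of_deriv_le (μ := volume)
    (F := fun z (ξ : Fin (n + 1) → ℝ) => fourierCoeff n g ξ *
      Complex.exp (Complex.I * ((∑ k, Function.update y j z k * ξ k : ℝ) : ℂ)))
    (bound := fun ξ => ‖fourierCoeff n g ξ * (Complex.I * (ξ j : ℂ))‖) (x₀ := z)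
    Filter.univ_mem (Eventually.of_forall fun z => Continuous.aestronglyMeasurable (by fun_prop)) ?_
    (Continuous.aestronglyMeasurable (by fun_prop)) (Eventually.of_forall fun ξ z _ => ?_)
    (integrable_fourierCoeff_mul_coord hg hc j).norm
    (Eventually.of_forall fun ξ z _ => hderiv ξ z)).2
  · simp only [integral_fourierCoeff_mul_exp hg hc] at hmain
    exact (hasDerivAt_comp_update hg y j z).unique hmain
  · refine (integrable_fourierCoeff hg hc).norm.mono'
      (Continuous.aestronglyMeasurable (by fun_prop)) (Eventually.of_forall fun ξ => ?_)
    rw [norm_mul, Complex.norm_exp_I_mul_ofReal, mul_one]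
  · rw [norm_mul, Complex.norm_exp_I_mul_ofReal, mul_one]

/-- The face of a smooth compactly supported function as a superposition of exponentials. -/
theorem face_eq_superposition {g : (Fin (n + 1) → ℝ) → ℂ} (hg : ContDiff ℝ ∞ g)
    (hc : HasCompactSupport g) (j : Fin (n + 1)) (x : Fin (n + 2) → ℝ) :
    face n j g x = ∫ p : (Fin (n + 1) → ℝ) × ℝ,
      (fourierCoeff n g p.1 * (Complex.I * (p.1 j : ℂ))) *
        Complex.exp (Complex.I * ((∑ k, x k * splitFreq j p k : ℝ) : ℂ))
      ∂(volume.prod (volume.restrict (Set.Ioc (0 : ℝ) 1))) := by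
  have hint := integrable_fourierCoeff_mul_coord_prod hg hc j
  have hsplit := continuous_splitFreq (n := n) j
  have hcoord : ∀ k, Continuous fun p => splitFreq (n := n) j p k := fun k =>
    (continuous_apply k).comp hsplit
  -- With s outermost, the inner ξ-integral is ∂ⱼg at a point of the segment.
  rw [integral_prod_symm]
  · rw [face, dslope_eq_intervalIntegral (fun z => hasDerivAt_comp_update hg _ j z)
      (((hg.continuous_fderiv (by simp)).comp
        (continuous_const.update j continuous_id)).clm_apply continuous_const),
      intervalIntegral.integral_of_le zero_le_one]
    simp only [fderiv_eq_integral_fourierCoeff hg hc, sum_update_mul_eq_sum_mul_splitFreq]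
  · refine hint.norm.mono' (hint.aestronglyMeasurable.mul
      (Continuous.aestronglyMeasurable (by fun_prop))) (Eventually.of_forall fun p => ?_)
    rw [norm_mul, Complex.norm_exp_I_mul_ofReal, mul_one]

end FaceSuperposition

/-! ### Inserting an element between two split factors. -/

section InsertSlot

theorem insertNth_succ_succ {X : Type*} {n : ℕ} (i : Fin (n + 1)) (a : X) (ρ : Fin (n + 1) → X)
    (k : Fin (n + 1)) :
    Fin.insertNth (α := fun _ => X) i.succ a ρ k.succ =
      Fin.insertNth (α := fun _ => X) i a (fun l => ρ l.succ) k := by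
  refine Fin.succAboveCases i ?_ (fun l => ?_) k
  · simp
  · rw [← Fin.succ_succAbove_succ, Fin.insertNth_apply_succAbove, Fin.insertNth_apply_succAbove]

theorem insertNth_succ_zero {X : Type*} {n : ℕ} (i : Fin (n + 1)) (a : X) (ρ : Fin (n + 1) → X) :
    Fin.insertNth (α := fun _ => X) i.succ a ρ 0 = ρ 0 := by
  rw [← Fin.succ_succAbove_zero i, Fin.insertNth_apply_succAbove]

theorem mul_prod_ofFn_succ {M : Type*} [Monoid M] {n : ℕ} (v : Fin (n + 2) → M)
    (ρ : Fin (n + 1) → M) :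
    v 0 * (List.ofFn fun k : Fin (n + 1) => ρ k * v k.succ).prod =
      v 0 * (ρ 0 * (v (Fin.succ 0) *
        (List.ofFn fun k : Fin n => ρ k.succ * v k.succ.succ).prod)) := by
  rw [List.ofFn_succ, List.prod_cons, mul_assoc (ρ 0)]

/-- A regrouping by associativity: the adjacent coefficients u and w with a in the slot between them
act as the single coefficient uaw. The induction strips leading factors until the split occurs in
position 0. -/
theorem sandwich_prod_insertNth {M : Type*} [Monoid M] {n : ℕ} (j : Fin (n + 1))
    (v : Fin (n + 1) → M) (ρ : Fin n → M) (u a w : M) :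
    Fin.insertNth (α := fun _ => M) j.castSucc u (Function.update v j w) 0 *
      (List.ofFn fun k : Fin (n + 1) => Fin.insertNth (α := fun _ => M) j a ρ k *
        Fin.insertNth (α := fun _ => M) j.castSucc u (Function.update v j w) k.succ).prod =
    Function.update v j (u * a * w) 0 *
      (List.ofFn fun k : Fin n => ρ k * Function.update v j (u * a * w) k.succ).prod := by
  have hzero : ∀ (m : ℕ) (v : Fin (m + 1) → M) (ρ : Fin m → M),
      Fin.insertNth (α := fun _ => M) (Fin.castSucc 0) u (Function.update v 0 w) 0 *
        (List.ofFn fun k : Fin (m + 1) => Fin.insertNth (α := fun _ => M) 0 a ρ k *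
          Fin.insertNth (α := fun _ => M) (Fin.castSucc 0) u (Function.update v 0 w) k.succ).prod =
      Function.update v 0 (u * a * w) 0 *
        (List.ofFn fun k : Fin m => ρ k * Function.update v 0 (u * a * w) k.succ).prod := by
    intro m v ρ
    rw [mul_prod_ofFn_succ]
    simp only [Fin.castSucc_zero, Fin.insertNth_zero', Fin.cons_zero, Fin.cons_succ,
      Function.update_self, Function.update_of_ne (Fin.succ_ne_zero _), mul_assoc]
  induction n with
  | zero => exact Fin.cases (hzero 0 v ρ) (fun i => i.elim0) j
  | succ n ih =>
    refine Fin.cases (hzero (n + 1) v ρ) (fun i => ?_) j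
    have htail : ∀ (x : M) (k : Fin (n + 1)), Function.update v i.succ x k.succ =
        Function.update (fun k => v k.succ) i x k := fun x k => by
      simp [Function.update_apply]
    rw [mul_prod_ofFn_succ, mul_prod_ofFn_succ]
    simp only [Fin.castSucc_succ, insertNth_succ_succ, insertNth_succ_zero, htail,
      Function.update_of_ne (Fin.succ_ne_zero i).symm]
    rw [ih i (fun k => v k.succ) (fun k => ρ k.succ)]

variable {A : Type*} [CStarAlgebra A]

/-- Precomposition with the insertion of an element in the `j`-th slot. -/
noncomputable def compInsertSlotL {n : ℕ} (j : Fin (n + 1)) (a : A) : Op A (n + 1) →L[ℂ] Op A n :=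
  LinearMap.mkContinuous
    { toFun := fun T => T.compInsertSlot j a
      map_add' := fun _ _ => rfl
      map_smul' := fun _ _ => rfl } ‖insertSlot n j a‖ fun T => by
    rw [mul_comm]
    exact T.toCLM.opNorm_comp_le (insertSlot n j a)

theorem compInsertSlotL_apply {n : ℕ} (j : Fin (n + 1)) (a : A) (T : Op A (n + 1)) :
    compInsertSlotL j a T = T.compInsertSlot j a := rfl

theorem compInsertSlot_sandwich {n : ℕ} (j : Fin (n + 1)) (v : Fin (n + 1) → A) (u a w : A) :
    (sandwich A (n + 1) (Fin.insertNth (α := fun _ => A) j.castSucc u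
      (Function.update v j w))).compInsertSlot j a =
      sandwich A n (Function.update v j (u * a * w)) := by
  refine Op.ext_tprod fun ρ => ?_
  rw [Op.compInsertSlot_tprod, sandwich_tprod, sandwich_tprod, sandwich_prod_insertNth]

/-- The point where both sides meet: up to the scalar iξⱼ, the right side is Duhamel's integrand
placed in slot j. -/
theorem compInsertSlot_expOp_splitFreq {n : ℕ} (h a : A) (j : Fin (n + 1)) (ξ : Fin (n + 1) → ℝ)
    (s : ℝ) :
    (expOp h (n + 1) (splitFreq j (ξ, s))).compInsertSlot j a =
      sandwich A n (Function.update (fun k => expI h (ξ k)) j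
        (expI h (s * ξ j) * a * expI h ((1 - s) * ξ j))) := by
  rw [← compInsertSlot_sandwich, expOp_eq_sandwich]
  congr 2
  funext k
  refine Fin.succAboveCases j.castSucc ?_ (fun l => ?_) k
  · simp [splitFreq]
  · rw [splitFreq, Fin.insertNth_apply_succAbove, Fin.insertNth_apply_succAbove]
    rcases eq_or_ne l j with rfl | hl
    · simp
    · simp [hl]

end InsertSlot

/-! ### Differentiating the calculus along a curve of self-adjoint elements. -/

section Derivative

variable {A : Type*} [CStarAlgebra A] {n : ℕ}

/-- The derivative of `e^{i ξ₀ h^{(0)}} ⋯ e^{i ξₙ h^{(n)}}` in the `j`-th occurrence of `h` in the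
direction `a`. -/
noncomputable def expOpDeriv (h a : A) (ξ : Fin (n + 1) → ℝ) (j : Fin (n + 1)) : Op A n :=
  sandwich A n (Function.update (fun k => expI h (ξ k)) j
    (∫ s in (0 : ℝ)..1,
      (Complex.I * (ξ j : ℂ)) • (expI h (s * ξ j) * a * expI h ((1 - s) * ξ j))))

/-- Linearity and continuity of `sandwich` in its j-th argument pull Duhamel's integral out of the
slot. -/
theorem expOpDeriv_eq_integral (h a : A) (ξ : Fin (n + 1) → ℝ) (j : Fin (n + 1)) :
    expOpDeriv h a ξ j = ∫ s in (0 : ℝ)..1, (Complex.I * (ξ j : ℂ)) •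
      (expOp h (n + 1) (splitFreq j (ξ, s))).compInsertSlot j a := by
  have hcont : Continuous fun s : ℝ =>
      (Complex.I * (ξ j : ℂ)) • (expI h (s * ξ j) * a * expI h ((1 - s) * ξ j)) :=
    (((continuous_const.expI (by fun_prop)).mul continuous_const).mul
      (continuous_const.expI (by fun_prop))).const_smul _
  have hL := ((sandwich A n).toContinuousLinearMap (fun k => expI h (ξ k))
    j).intervalIntegral_comp_comm (hcont.intervalIntegrable (μ := volume) 0 1)
  rw [expOpDeriv]
  refine hL.symm.trans ?_
  congr 1
  funext s
  rw [map_smul, compInsertSlot_expOp_splitFreq]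
  rfl

theorem hasDerivAt_expOp_comp {γ : ℝ → A} {a : A} {u : ℝ} (hγ : HasDerivAt γ a u)
    (hsa : ∀ v, IsSelfAdjoint (γ v)) (ξ : Fin (n + 1) → ℝ) :
    HasDerivAt (fun v => expOp (γ v) n ξ) (∑ j, expOpDeriv (γ u) a ξ j) u := by
  simp only [expOp_eq_sandwich]
  have h1 : HasDerivAt (fun v => fun k => expI (γ v) (ξ k))
      (fun j => ∫ s in (0 : ℝ)..1, (Complex.I * (ξ j : ℂ)) •
        (expI (γ u) (s * ξ j) * a * expI (γ u) ((1 - s) * ξ j))) u :=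
    hasDerivAt_pi.2 fun k => hasDerivAt_expI_comp hγ hsa (ξ k)
  have h2 := (((sandwich A n).hasFDerivAt (fun k => expI (γ u) (ξ k))).restrictScalars
    ℝ).comp_hasDerivAt u h1
  refine h2.congr_deriv ?_
  simp [expOpDeriv]

theorem integrable_smul_expOp_splitFreq {h : A} (hsa : IsSelfAdjoint h)
    {g : (Fin (n + 1) → ℝ) → ℂ} (hg : ContDiff ℝ ∞ g) (hc : HasCompactSupport g)
    (j : Fin (n + 1)) :
    Integrable (fun p : (Fin (n + 1) → ℝ) × ℝ => (fourierCoeff n g p.1 *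
      (Complex.I * (p.1 j : ℂ))) • expOp h (n + 1) (splitFreq j p))
      (volume.prod (volume.restrict (Set.Ioc (0 : ℝ) 1))) := by
  have hint := integrable_fourierCoeff_mul_coord_prod hg hc j
  refine (hint.norm.mul_const ‖sandwich A (n + 1)‖).mono' (hint.aestronglyMeasurable.smul
    ((continuous_expOp h (n + 1)).comp (continuous_splitFreq j)).aestronglyMeasurable)
    (Eventually.of_forall fun p => ?_)
  rw [norm_smul]
  exact mul_le_mul_of_nonneg_left (norm_expOp_le hsa _ _) (norm_nonneg _)

theorem integral_smul_compInsertSlot_eq (h a : A) (g : (Fin (n + 1) → ℝ) → ℂ) (j : Fin (n + 1))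
    (ξ : Fin (n + 1) → ℝ) :
    ∫ s in Set.Ioc (0 : ℝ) 1, compInsertSlotL j a ((fourierCoeff n g ξ *
      (Complex.I * (ξ j : ℂ))) • expOp h (n + 1) (splitFreq j (ξ, s))) =
      fourierCoeff n g ξ • expOpDeriv h a ξ j := by
  rw [expOpDeriv_eq_integral, intervalIntegral.integral_of_le zero_le_one, ← integral_smul]
  simp only [map_smul, mul_smul, compInsertSlotL_apply]

/-- The function is the s-marginal of the jointly integrable integrand for the face, so Fubini gives
integrability without a separate estimate. -/
theorem integrable_fourierCoeff_smul_expOpDeriv {h : A} (hsa : IsSelfAdjoint h) (a : A)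
    {g : (Fin (n + 1) → ℝ) → ℂ} (hg : ContDiff ℝ ∞ g) (hc : HasCompactSupport g)
    (j : Fin (n + 1)) :
    Integrable fun ξ => fourierCoeff n g ξ • expOpDeriv h a ξ j := by
  have h1 := ((compInsertSlotL j a).integrable_comp
    (integrable_smul_expOp_splitFreq hsa hg hc j)).integral_prod_left
  simpa only [integral_smul_compInsertSlot_eq] using h1

/-- The Schwartz functional calculus of a face. -/
theorem compInsertSlot_schwartzIntegral_face {h : A} (hsa : IsSelfAdjoint h) (a : A)
    {g : (Fin (n + 1) → ℝ) → ℂ} (hg : ContDiff ℝ ∞ g) (hc : HasCompactSupport g)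
    (j : Fin (n + 1)) {φ : ℝ → ℂ} (hφ : ContDiff ℝ ∞ φ) (hφc : HasCompactSupport φ)
    (h1 : ∀ x ∈ spectrum ℝ h, φ x = 1) :
    (schwartzIntegral h (n + 1)
      fun x => tensorPower (n + 1) φ x * face n j g x).compInsertSlot j a =
      ∫ ξ, fourierCoeff n g ξ • expOpDeriv h a ξ j := by
  have hint := integrable_smul_expOp_splitFreq hsa hg hc j
  simp only [face_eq_superposition hg hc j]
  rw [schwartzIntegral_tensorPower_mul_superposition hsa hφ hφc h1
    (integrable_fourierCoeff_mul_coord_prod hg hc j) (continuous_splitFreq j).measurable,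
    ← compInsertSlotL_apply, ← ContinuousLinearMap.integral_comp_comm _ hint,
    integral_prod _ ((compInsertSlotL j a).integrable_comp hint)]
  simp only [integral_smul_compInsertSlot_eq]

/-- The pointwise derivative passes through the ξ-integral by dominated convergence: near u the
slopes of γ stay below ‖a‖ + 1, so the quotients are bounded by a multiple of ‖ξ‖ times the
transform. -/
theorem hasDerivAt_schwartzIntegral {γ : ℝ → A} {a : A} {u : ℝ} (hγ : HasDerivAt γ a u)
    (hsa : ∀ v, IsSelfAdjoint (γ v)) {g : (Fin (n + 1) → ℝ) → ℂ} (hg : ContDiff ℝ ∞ g)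
    (hc : HasCompactSupport g) :
    HasDerivAt (fun v => schwartzIntegral (γ v) n g)
      (∑ j, ∫ ξ, fourierCoeff n g ξ • expOpDeriv (γ u) a ξ j) u := by
  have hint : ∀ v, Integrable fun ξ => fourierCoeff n g ξ • expOp (γ v) n ξ := fun v =>
    integrable_prod_smul_expOp (hsa v) n (integrable_fourierCoeff hg hc)
  rw [← integral_finsetSum _ fun j _ =>
    integrable_fourierCoeff_smul_expOpDeriv (hsa u) a hg hc j]
  simp only [← Finset.smul_sum]
  rw [hasDerivAt_iff_tendsto_slope]
  have hslope : slope (fun v => schwartzIntegral (γ v) n g) u = fun v =>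
      ∫ ξ, fourierCoeff n g ξ • slope (fun v => expOp (γ v) n ξ) u v := by
    funext v
    rw [slope_def_module, schwartzIntegral, schwartzIntegral, ← integral_sub (hint v) (hint u),
      ← integral_smul]
    congr 1
    funext ξ
    rw [slope_def_module, ← smul_sub, smul_comm]
  rw [hslope]
  have hbound : ∀ᶠ v in 𝓝[≠] u, ‖slope γ u v‖ < ‖a‖ + 1 :=
    (hasDerivAt_iff_tendsto_slope.1 hγ).norm.eventually (gt_mem_nhds (lt_add_one _))
  refine tendsto_integral_filter_of_dominated_convergence
    (fun ξ => ‖sandwich A n‖ * (n + 1 : ℕ) * (‖a‖ + 1) * (‖ξ‖ * ‖fourierCoeff n g ξ‖)) ?_ ?_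
    ((integrable_norm_mul_fourierCoeff hg hc).const_mul _) ?_
  · refine Eventually.of_forall fun v => Continuous.aestronglyMeasurable ?_
    simp only [slope_def_module]
    exact (continuous_fourierCoeff hg hc).smul
      (((continuous_expOp (γ v) n).sub (continuous_expOp (γ u) n)).const_smul _)
  · filter_upwards [hbound] with v hv
    refine Eventually.of_forall fun ξ => ?_
    rw [slope_def_module, norm_smul] at hv ⊢
    rw [norm_smul]
    have h1 := norm_expOp_sub_expOp_le (hsa u) (hsa v) n ξ
    calc ‖fourierCoeff n g ξ‖ * (‖(v - u)⁻¹‖ * ‖expOp (γ v) n ξ - expOp (γ u) n ξ‖)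
        ≤ ‖fourierCoeff n g ξ‖ * (‖(v - u)⁻¹‖ *
          (‖sandwich A n‖ * (n + 1 : ℕ) * (‖ξ‖ * ‖γ v - γ u‖))) := by gcongr
      _ = ‖sandwich A n‖ * (n + 1 : ℕ) * (‖(v - u)⁻¹‖ * ‖γ v - γ u‖) *
          (‖ξ‖ * ‖fourierCoeff n g ξ‖) := by ring
      _ ≤ ‖sandwich A n‖ * (n + 1 : ℕ) * (‖a‖ + 1) * (‖ξ‖ * ‖fourierCoeff n g ξ‖) := by
        gcongr
  · exact Eventually.of_forall fun ξ =>
      (hasDerivAt_iff_tendsto_slope.1 (hasDerivAt_expOp_comp hγ hsa ξ)).const_smul _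

end Derivative

/-! ### The flow of automorphisms and the derivative formula. -/

section Automorphism

variable {A : Type*} [CStarAlgebra A] {n : ℕ}

theorem spectrum_real_starAlgEquiv (e : A ≃⋆ₐ[ℂ] A) (h : A) :
    spectrum ℝ (e h) = spectrum ℝ h :=
  AlgEquiv.spectrum_eq ((e.toAlgEquiv : A ≃ₐ[ℂ] A).restrictScalars ℝ) h

/-- Invariance of the spectrum makes one `g` valid along the whole orbit, so only the operator, and
not the function, varies with t. -/
theorem IsLocalization.map_starAlgEquiv {h : A} {f g : (Fin (n + 1) → ℝ) → ℂ}
    (hg : IsLocalization h n f g) (e : A ≃⋆ₐ[ℂ] A) : IsLocalization (e h) n f g where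
  contDiff := hg.contDiff
  hasCompactSupport := hg.hasCompactSupport
  eventuallyEq := by
    rw [specCube, spectrum_real_starAlgEquiv]
    exact hg.eventuallyEq

theorem compInsertSlot_rearr_face {h : A} (hsa : IsSelfAdjoint h) (a : A)
    {f g : (Fin (n + 1) → ℝ) → ℂ} (hg : IsLocalization h n f g) (j : Fin (n + 1)) :
    (rearr h (n + 1) (face n j f)).compInsertSlot j a =
      ∫ ξ, fourierCoeff n g ξ • expOpDeriv h a ξ j := by
  obtain ⟨W, hW, hKW, hWe⟩ := eventually_nhdsSet_iff_exists.1 hg.eventuallyEq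
  obtain ⟨U, hU, hKU, hUW⟩ := exists_cube_subset (isCompact_spectrum_real h) hW hKW
  obtain ⟨φ, hφ, hc, -, V, hV, hKV, hφV⟩ := exists_cutoff (isCompact_spectrum_real h) hU hKU
  have hloc : IsLocalization h (n + 1) (face n j f)
      fun x => tensorPower (n + 1) φ x * face n j g x :=
    -- The face of `g` is smooth everywhere, so the cutoff may have any support. On V the cutoff is
    -- 1 and on U the faces of `g` and `f` agree, whence the intersection.
    isLocalization_tensorPower_mul isOpen_univ hφ hc (Set.subset_univ _)
      (contDiff_face hg.contDiff j).contDiffOn (hV.inter hU) (Set.subset_inter hKV hKU)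
      (fun x hx => hφV x hx.1) fun x hx =>
        face_congr hU (fun y hy => hWe y (hUW hy)) j
          (Set.pi_mono (fun _ _ => Set.inter_subset_right) hx)
  rw [rearr_eq_schwartzIntegral hsa hloc, compInsertSlot_schwartzIntegral_face hsa a hg.contDiff
    hg.hasCompactSupport j hφ hc fun x hx => hφV x (hKV hx)]

theorem hasDerivAt_rearr {α : Multiplicative ℝ →* (A ≃⋆ₐ[ℂ] A)} {h : A} (hsa : IsSelfAdjoint h)
    (hdiff : DifferentiableAt ℝ (fun t : ℝ => α (Multiplicative.ofAdd t) h) 0)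
    {f : (Fin (n + 1) → ℝ) → ℂ} (hf : f ∈ CSpec h n) :
    HasDerivAt (fun t : ℝ => rearr (α (Multiplicative.ofAdd t) h) n f)
      (∑ j, (rearr h (n + 1) (face n j f)).compInsertSlot j (nabla α h)) 0 := by
  obtain ⟨g, hg⟩ := exists_isLocalization hf
  have hsa' : ∀ t : ℝ, IsSelfAdjoint (α (Multiplicative.ofAdd t) h) := fun t => hsa.map _
  have h0 : α (Multiplicative.ofAdd 0) h = h := by simp
  have hfun : (fun t : ℝ => rearr (α (Multiplicative.ofAdd t) h) n f) =
      fun t : ℝ => schwartzIntegral (α (Multiplicative.ofAdd t) h) n g := funext fun t =>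
    rearr_eq_schwartzIntegral (hsa' t) (hg.map_starAlgEquiv _)
  have hmain := hasDerivAt_schwartzIntegral hdiff.hasDerivAt hsa' hg.contDiff hg.hasCompactSupport
  rw [h0] at hmain
  rw [hfun]
  refine hmain.congr_deriv (Finset.sum_congr rfl fun j _ => ?_)
  rw [compInsertSlot_rearr_face hsa _ hg]
  rfl

end Automorphism

end Rearrangement

theorem mainTheorem4 {A : Type*} [CStarAlgebra A]
    (α : Multiplicative ℝ →* (A ≃⋆ₐ[ℂ] A))
    (h : A) (hsa : IsSelfAdjoint h)
    (hdiff : DifferentiableAt ℝ (fun t : ℝ => α (Multiplicative.ofAdd t) h) 0)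
    (n : ℕ) (f : (Fin (n + 1) → ℝ) → ℂ) (hf : f ∈ Rearrangement.CSpec h n) :
    ((∃ g, Rearrangement.IsLocalization h n f g) ∧
      ∀ g, Rearrangement.IsLocalization h n f g →
        Rearrangement.rearr h n f = Rearrangement.schwartzIntegral h n g) ∧
    (∀ j : Fin (n + 1), Rearrangement.face n j f ∈ Rearrangement.CSpec h (n + 1)) ∧
    DifferentiableAt ℝ
      (fun t : ℝ => Rearrangement.rearr (α (Multiplicative.ofAdd t) h) n f) 0 ∧
    Rearrangement.nablaRearr α h n f =
      ∑ j : Fin (n + 1),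
        (Rearrangement.rearr h (n + 1) (Rearrangement.face n j f)).compInsertSlot j
          (Rearrangement.nabla α h) :=
  ⟨⟨Rearrangement.exists_isLocalization hf, fun _ hg =>
      Rearrangement.rearr_eq_schwartzIntegral hsa hg⟩,
    fun j => Rearrangement.face_mem_CSpec hf j,
    (Rearrangement.hasDerivAt_rearr hsa hdiff hf).differentiableAt,
    (Rearrangement.hasDerivAt_rearr hsa hdiff hf).deriv⟩
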